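/- **Setting.** Consider a POMDP with finite sets $\mathcal U,\mathcal Z,\mathcal A$ of hidden states, observations and actions, rewards in a set $\mathcal R$ (with discrete conditional laws) and horizon $H$. An initial state $u_0$ is drawn, and a preliminary observation $z_{-1}$ is drawn given $u_0$, independently of everything else given $u_0$. At each time $0\le i\le H$ an observation $z_i\sim O(\cdot\mid u_i)$ is emitted, an action $a_i$ is chosen, a reward $r_i\sim R(\cdot\mid u_i,a_i)$ is received, and $u_{i+1}\sim T(\cdot\mid u_i,a_i)$, where $r_i$ and $u_{i+1}$ are independent given $(u_i,a_i)$. $P^b$ is the law of the trajectory when $a_i\sim\pi_b^{(i)}(\cdot\mid u_i)$ (behavior policy), and $P^e$ the law when $a_i\sim\pi_e^{(i)}(\cdot\mid h_i^o)$ with $h_i^o=(z_0,a_0,\dots,a_{i-1},z_i)$ (evaluation policy). "$\,\|\,a_j$" means that the action at time $j$ is set to $a_j$ by intervention, the other actions still following $\pi_b$. Capital letters denote vectorization over all values: $\mathcal H^o_{i-1}$ ranges over the histories $(z_0,a_0,\dots,a_{i-2},z_{i-1})$ (over $z_{-1}$ if $i=0$), and $\mathcal F^o_i$ over the futures $(z_i,z_{i+1},a_{i+1},\dots,z_H,a_H)$;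 what stands before the bar indexes rows, what stands after it columns. A conditional probability given a null event is read as $0$. $X^+$ is the Moore–Penrose pseudoinverse. **Theorem.** Let $0\le t\le H$, and assume that for all $i\le t$ and $a\in\mathcal A$: (A1) $\operatorname{rank} P^b(\mathcal F^o_i\mid a_i=a,\mathcal H^o_{i-1})=|\mathcal U|$; (A2) there is $r\in\mathcal R$ such that the probabilities $P^b(r_i=r\mid a_i=a,u_i=u)$, $u\in\mathcal U$, are pairwise distinct. Then the following hold. 1. There are matrices $M_{i,a}\in\mathbb R^{|\mathcal U|\times|\mathcal F^o_i|}$ with $\operatorname{rank}M_{i,a}=\operatorname{rank}\big(M_{i,a}P^b(\mathcal F^o_i\mid a_i=a,\mathcal H^o_{i-1})\big)=|\mathcal U|$ for all $i\le t$ and $a\in\mathcal A$. For every such choice, with $M'_{i,a}:=\big(M_{i,a}P^b(\mathcal F^o_i\mid a_i=a,\mathcal H^o_{i-1})\big)^+$, every evaluation policy $\pi_e$ and every reward value $r_t\in\mathcal R$, $$P^e(r_t)=\sum_{(z_0,a_0,\dots,z_t,a_t)}\Big(\prod_{i=0}^t\pi_e^{(i)}(a_i\mid h^o_i)\Big)\,P^b(r_t,z_t\mid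 a_t,\mathcal H^o_{t-1})\,M'_{t,a_t}\;\prod_{i=t-1}^{0}\Big(M_{i+1,a_{i+1}}\,P^b(\mathcal F^o_{i+1},z_i\mid a_i,\mathcal H^o_{i-1}\,\|\,a_{i+1})\,M'_{i,a_i}\Big)\;M_{0,a_0}\,P^b(\mathcal F^o_0\,\|\,a_0),$$ the factors of the matrix product being ordered from $i=t-1$ on the left to $i=0$ on the right. 2. The matrices $P^b(\mathcal F^o_{i+1},z_i\mid a_i,\mathcal H^o_{i-1}\,\|\,a_{i+1})$, for $i<t$ and all $z_i,a_i,a_{i+1}$, and the vectors $P^b(\mathcal F^o_0\,\|\,a_0)$ are identifiable: any two models (POMDP and behavior policy) with the same $\mathcal Z,\mathcal A,\mathcal R,H$, possibly with different hidden state sets, that both satisfy the assumptions and induce the same law of the observable data $(z_{-1},z_0,a_0,r_0,\dots,z_H,a_H,r_H)$ have the same such matrices and vectors. 3. Let $i\le t$ and $a\in\mathcal A$, and fix one history $h_0$ and one future $f_0$ to be left out. Let $P$ be the matrix whose rows are indexed by a symbol $*$ and the histories $h\ne h_0$ of $\mathcal H^o_{i-1}$, and whose columns are indexed by $*$ and the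 futures $f\ne f_0$ of $\mathcal F^o_i$, with entries $P_{h,f}=P^b(h,f\mid a_i=a)$, $P_{h,*}=P^b(h\mid a_i=a)$, $P_{*,f}=P^b(f\mid a_i=a)$, $P_{*,*}=1$. For $r\in\mathcal R$ let $Q$ be the matrix obtained by replacing these by the joint probabilities with the event $r_i=r$, still conditional on $a_i=a$. Then $P$ has $|\mathcal U|$ linearly independent columns that include the column $*$. For every such list $\Lambda$ of columns, let $L(\Lambda)$ be the matrix that selects them, and let $U(\Lambda)$ be the matrix with rows $u\in\mathcal U$ and columns $\Lambda$ with entries $P^b(f\mid a_i=a,u_i=u)$ for $f\in\Lambda$, and $1$ in the column $*$. Then $U(\Lambda)$ is invertible and, for every $r$, $$(P\,L(\Lambda))^+\,Q\,L(\Lambda)=U(\Lambda)^{-1}\operatorname{diag}\big(P^b(r_i=r\mid a_i=a,u_i=u)\big)_{u\in\mathcal U}\,U(\Lambda).$$ -/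

import Mathlib

open scoped Matrix

universe u v w x

/-! ### The Moore–Penrose pseudoinverse of a real matrix -/

/-- The four Penrose equations: `X` is the Moore–Penrose pseudoinverse of `B`. -/
structure IsMoorePenrose {m n : Type*} [Fintype m] [Fintype n]
    (B : Matrix m n ℝ) (X : Matrix n m ℝ) : Prop where
  mul_mul_self : B * X * B = B
  mul_mul_inv : X * B * X = X
  symm_left : (B * X)ᵀ = B * X
  symm_right : (X * B)ᵀ = X * B

/-- A real symmetric matrix has a symmetric, commuting generalized inverse. -/
theorem exists_symm_ginv {m : Type*} [Fintype m] (S : Matrix m m ℝ) (hS : Sᵀ = S) :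
    ∃ G : Matrix m m ℝ, Gᵀ = G ∧ S * G * S = S ∧ G * S * G = G ∧ (S * G)ᵀ = S * G := by
  classical
  have hH : S.IsHermitian := by
    rw [Matrix.IsHermitian, Matrix.conjTranspose_eq_transpose_of_trivial, hS]
  obtain ⟨V, d, hV, hSV⟩ : ∃ (V : Matrix m m ℝ) (d : m → ℝ), Vᵀ * V = 1 ∧
      S = V * Matrix.diagonal d * Vᵀ := by
    refine ⟨hH.eigenvectorUnitary, hH.eigenvalues, ?_, ?_⟩
    · have h := Unitary.coe_star_mul_self hH.eigenvectorUnitary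
      simpa [Matrix.star_eq_conjTranspose, Matrix.conjTranspose_eq_transpose_of_trivial] using h
    · have h := hH.spectral_theorem
      simpa [Unitary.conjStarAlgAut_apply, Matrix.star_eq_conjTranspose,
        Matrix.conjTranspose_eq_transpose_of_trivial, Function.comp_def] using h
  have key : ∀ p q : m → ℝ, (V * Matrix.diagonal p * Vᵀ) * (V * Matrix.diagonal q * Vᵀ)
      = V * Matrix.diagonal (fun k => p k * q k) * Vᵀ := by
    intro p q
    calc (V * Matrix.diagonal p * Vᵀ) * (V * Matrix.diagonal q * Vᵀ)
        = V * Matrix.diagonal p * (Vᵀ * V) * Matrix.diagonal q * Vᵀ := by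
          simp only [Matrix.mul_assoc]
      _ = _ := by
          rw [hV, Matrix.mul_one, Matrix.mul_assoc V, Matrix.diagonal_mul_diagonal]
  have symm : ∀ p : m → ℝ, (V * Matrix.diagonal p * Vᵀ)ᵀ = V * Matrix.diagonal p * Vᵀ := by
    intro p
    simp [Matrix.transpose_mul, Matrix.mul_assoc]
  refine ⟨V * Matrix.diagonal (fun k => (d k)⁻¹) * Vᵀ, symm _, ?_, ?_, ?_⟩
  · rw [hSV, key, key]
    congr 3
    funext k
    exact mul_inv_mul_cancel (d k)
  · rw [hSV, key, key]
    congr 3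
    funext k
    by_cases h : d k = 0 <;> simp [h]
  · rw [hSV, key, symm]

theorem exists_isMoorePenrose {m n : Type*} [Fintype m] [Fintype n] (B : Matrix m n ℝ) :
    ∃ X, IsMoorePenrose B X := by
  classical
  obtain ⟨G, hG, h1, h2, h3⟩ := exists_symm_ginv (B * Bᵀ) (by simp)
  refine ⟨Bᵀ * G, ?_, ?_, ?_, ?_⟩
  · have h4 : (B * Bᵀ * G * B - B) * (B * Bᵀ * G * B - B)ᵀ = 0 := by
      have h5 : (B * Bᵀ * G * B - B) * (B * Bᵀ * G * B - B)ᵀ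
          = (B * Bᵀ * G * (B * Bᵀ) - B * Bᵀ) * (B * Bᵀ * G - 1)ᵀ := by
        simp only [Matrix.transpose_sub, Matrix.transpose_mul, Matrix.transpose_transpose,
          Matrix.sub_mul, Matrix.mul_sub, Matrix.mul_assoc, Matrix.transpose_one, Matrix.mul_one]
      rw [h5, h1, sub_self, Matrix.zero_mul]
    rw [← Matrix.conjTranspose_eq_transpose_of_trivial (B * Bᵀ * G * B - B),
      Matrix.self_mul_conjTranspose_eq_zero] at h4
    rw [← Matrix.mul_assoc]
    exact sub_eq_zero.mp h4
  · calc Bᵀ * G * B * (Bᵀ * G) = Bᵀ * (G * (B * Bᵀ) * G) := by simp only [Matrix.mul_assoc]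
      _ = Bᵀ * G := by rw [h2]
  · rw [← Matrix.mul_assoc]
    exact h3
  · simp [Matrix.transpose_mul, hG, Matrix.mul_assoc]

theorem IsMoorePenrose.unique {m n : Type*} [Fintype m] [Fintype n] {B : Matrix m n ℝ}
    {X Y : Matrix n m ℝ} (hX : IsMoorePenrose B X) (hY : IsMoorePenrose B Y) : X = Y := by
  have h1 : B * X = B * Y := by
    calc B * X = (B * Y) * (B * X) := by rw [← Matrix.mul_assoc, hY.mul_mul_self]
      _ = (B * Y)ᵀ * (B * X)ᵀ := by rw [hX.symm_left, hY.symm_left]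
      _ = (B * X * B * Y)ᵀ := by rw [← Matrix.transpose_mul]; simp only [Matrix.mul_assoc]
      _ = B * Y := by rw [hX.mul_mul_self, hY.symm_left]
  have h2 : X * B = Y * B := by
    calc X * B = (X * B) * (Y * B) := by
          rw [← Matrix.mul_assoc, Matrix.mul_assoc X B Y, Matrix.mul_assoc X,
            hY.mul_mul_self]
      _ = (X * B)ᵀ * (Y * B)ᵀ := by rw [hX.symm_right, hY.symm_right]
      _ = (Y * (B * X * B))ᵀ := by rw [← Matrix.transpose_mul]; simp only [Matrix.mul_assoc]
      _ = Y * B := by rw [hX.mul_mul_self, hY.symm_right]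
  calc X = X * B * X := hX.mul_mul_inv.symm
    _ = Y * B * Y := by rw [h2, Matrix.mul_assoc, h1, ← Matrix.mul_assoc]
    _ = Y := hY.mul_mul_inv

/-- The Moore–Penrose pseudoinverse of a real matrix. -/
noncomputable def pinv {m n : Type*} [Fintype m] [Fintype n] (B : Matrix m n ℝ) :
    Matrix n m ℝ :=
  (exists_isMoorePenrose B).choose

theorem pinv_spec {m n : Type*} [Fintype m] [Fintype n] (B : Matrix m n ℝ) :
    IsMoorePenrose B (pinv B) :=
  (exists_isMoorePenrose B).choose_spec

/-! ### POMDPs, policies and the law of a trajectory -/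

/-- An observable history `(z₀, a₀, …, a_{n-1}, z_n)` of length `n`. -/
abbrev Hist (Z : Type v) (A : Type w) (n : ℕ) : Type (max v w) :=
  (Fin (n + 1) → Z) × (Fin n → A)

/-- An observable future `(z, (z₁, a₁), …, (z_n, a_n))` with `n` further steps. -/
abbrev Fut (Z : Type v) (A : Type w) (n : ℕ) : Type (max v w) :=
  Z × (Fin n → Z × A)

/-- A POMDP with hidden states `U`, observations `Z`, actions `A` and rewards in `ρ`, together
with the law of the initial hidden state `u₀` and the law, given `u₀`, of the observation `z₋₁`
that precedes the initial time step. -/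
structure POMDP (U : Type u) (Z : Type v) (A : Type w) (ρ : Type x) where
  init : PMF U
  pre : U → PMF Z
  emit : U → PMF Z
  trans : U → A → PMF U
  reward : U → A → PMF ρ

/-- A policy: the law of the action at time `n`, given the current hidden state and the observable
history of length `n`. -/
abbrev Policy (U : Type u) (Z : Type v) (A : Type w) := (n : ℕ) → U → Hist Z A n → PMF A

/-- A policy which depends on the hidden state only (the behavior policy). -/
abbrev HiddenPolicy (U : Type u) (A : Type w) := ℕ → U → PMF A

/-- A policy which depends on the observable history only (the evaluation policy). -/
abbrev ObsPolicy (Z : Type v) (A : Type w) := (n : ℕ) → Hist Z A n → PMF A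

def HiddenPolicy.toPolicy {U : Type u} {A : Type w} (Z : Type v) (π : HiddenPolicy U A) :
    Policy U Z A :=
  fun n s _ => π n s

def ObsPolicy.toPolicy {Z : Type v} {A : Type w} (U : Type u) (π : ObsPolicy Z A) :
    Policy U Z A :=
  fun n _ h => π n h

open Classical in
/-- Intervening on the action at time `j`: this action is set to `a`, all the other actions are
still chosen by `π`. -/
noncomputable def Policy.intervene {U : Type u} {Z : Type v} {A : Type w} (π : Policy U Z A)
    (j : ℕ) (a : A) : Policy U Z A :=
  fun n s h => if n = j then PMF.pure a else π n s h

/-- A trajectory with horizon `N`: `z₋₁` and `(uᵢ, zᵢ, aᵢ, rᵢ)` for `0 ≤ i ≤ N`. -/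
structure Traj (U : Type u) (Z : Type v) (A : Type w) (ρ : Type x) (N : ℕ) where
  zpre : Z
  st : Fin (N + 1) → U
  ob : Fin (N + 1) → Z
  act : Fin (N + 1) → A
  rew : Fin (N + 1) → ρ

/-- The observable history of length `i` inside the sequence `z₀, a₀, …, z_n, a_n`. -/
def prefixHist {Z : Type v} {A : Type w} {n : ℕ} (zs : Fin (n + 1) → Z) (as : Fin (n + 1) → A)
    (i : Fin (n + 1)) : Hist Z A i :=
  (fun k => zs ⟨k, by omega⟩, fun k => as ⟨k, by omega⟩)

/-- The proxy history at time `i`, which is `(z₀, a₀, …, a_{i-2}, z_{i-1})` if `i ≥ 1`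
and `(z₋₁)` if `i = 0`. -/
def Traj.past {U : Type u} {Z : Type v} {A : Type w} {ρ : Type x} {N : ℕ}
    (τ : Traj U Z A ρ N) (i : Fin (N + 1)) : Hist Z A (i - 1) :=
  (fun k => if (i : ℕ) = 0 then τ.zpre else τ.ob ⟨k, by omega⟩, fun k => τ.act ⟨k, by omega⟩)

/-- The future `(z_i, z_{i+1}, a_{i+1}, …, z_N, a_N)` at time `i` (without the action `a_i`). -/
def Traj.fut {U : Type u} {Z : Type v} {A : Type w} {ρ : Type x} {N : ℕ}
    (τ : Traj U Z A ρ N) (i : Fin (N + 1)) : Fut Z A (N - i) :=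
  (τ.ob i, fun k => (τ.ob ⟨i + 1 + k, by omega⟩, τ.act ⟨i + 1 + k, by omega⟩))

/-- The observable part of a trajectory: everything but the hidden states. -/
def Traj.obs {U : Type u} {Z : Type v} {A : Type w} {ρ : Type x} {N : ℕ}
    (τ : Traj U Z A ρ N) : Z × (Fin (N + 1) → Z × A × ρ) :=
  (τ.zpre, fun i => (τ.ob i, τ.act i, τ.rew i))

namespace POMDP

variable {U : Type u} {Z : Type v} {A : Type w} {ρ : Type x} {N : ℕ}

/-- The probability of a single trajectory under the policy `π`. -/
noncomputable def weight (M : POMDP U Z A ρ) (π : Policy U Z A) (τ : Traj U Z A ρ N) : ENNReal :=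
  M.init (τ.st 0) * M.pre (τ.st 0) τ.zpre *
    (∏ i : Fin (N + 1), M.emit (τ.st i) (τ.ob i) *
      π i (τ.st i) (prefixHist τ.ob τ.act i) (τ.act i) * M.reward (τ.st i) (τ.act i) (τ.rew i)) *
    ∏ i : Fin N, M.trans (τ.st i.castSucc) (τ.act i.castSucc) (τ.st i.succ)

/-- The probability of an event under the policy `π`. -/
noncomputable def prob (M : POMDP U Z A ρ) (π : Policy U Z A) (E : Set (Traj U Z A ρ N)) : ℝ :=
  (∑' τ, E.indicator (M.weight π) τ).toReal

/-- The conditional probability of `E` given `C` (which is `0` if `C` has probability `0`). -/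
noncomputable def condProb (M : POMDP U Z A ρ) (π : Policy U Z A)
    (E C : Set (Traj U Z A ρ N)) : ℝ :=
  M.prob π (E ∩ C) / M.prob π C

/-- `P^b(Fᵢ | aᵢ = a, Hᵢ₋₁)`. -/
noncomputable def futMatrix (M : POMDP U Z A ρ) (πb : HiddenPolicy U A) (i : Fin (N + 1)) (a : A) :
    Matrix (Fut Z A (N - i)) (Hist Z A (i - 1)) ℝ :=
  Matrix.of fun f h => M.condProb (N := N) (πb.toPolicy Z)
    {τ | τ.fut i = f} {τ | τ.act i = a ∧ τ.past i = h}

/-- The row vector `P^b(rᵢ = r, zᵢ = z | aᵢ = a, Hᵢ₋₁)`. -/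
noncomputable def rewRow (M : POMDP U Z A ρ) (πb : HiddenPolicy U A) (i : Fin (N + 1))
    (r : ρ) (z : Z) (a : A) : Hist Z A (i - 1) → ℝ :=
  fun h => M.condProb (N := N) (πb.toPolicy Z)
    {τ | τ.rew i = r ∧ τ.ob i = z} {τ | τ.act i = a ∧ τ.past i = h}

/-- The interventional matrix `P^b(Fᵢ₊₁, zᵢ = z | aᵢ = a, Hᵢ₋₁ || aᵢ₊₁ = a')`. -/
noncomputable def doMatrix (M : POMDP U Z A ρ) (πb : HiddenPolicy U A) (i : Fin N)
    (z : Z) (a a' : A) :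
    Matrix (Fut Z A (N - i.succ)) (Hist Z A (i.castSucc - 1)) ℝ :=
  Matrix.of fun f h => M.condProb (N := N) ((πb.toPolicy Z).intervene i.succ a')
    {τ | τ.fut i.succ = f ∧ τ.ob i.castSucc = z}
    {τ | τ.act i.castSucc = a ∧ τ.past i.castSucc = h}

/-- The interventional column vector `P^b(F₀ || a₀ = a)`. -/
noncomputable def doInit (M : POMDP U Z A ρ) (πb : HiddenPolicy U A) (N : ℕ) (a : A) :
    Fut Z A (N - (0 : Fin (N + 1))) → ℝ :=
  fun f => M.prob (N := N) ((πb.toPolicy Z).intervene 0 a) {τ | τ.fut 0 = f}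

/-- The reward probability `P^b(rᵢ = r | aᵢ = a, uᵢ = s)`. -/
noncomputable def rewProb (M : POMDP U Z A ρ) (πb : HiddenPolicy U A) (i : Fin (N + 1))
    (r : ρ) (a : A) (s : U) : ℝ :=
  M.condProb (N := N) (πb.toPolicy Z) {τ | τ.rew i = r} {τ | τ.act i = a ∧ τ.st i = s}

/-- The assumptions up to time `t`: the future–history matrices have rank `|U|`, and for each
action some reward value has pairwise distinct probabilities across the hidden states. -/
structure Assumptions [Fintype U] [Fintype Z] [Fintype A] (M : POMDP U Z A ρ)
    (πb : HiddenPolicy U A) (t : Fin (N + 1)) : Prop where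
  rank_eq : ∀ i ≤ t, ∀ a, (M.futMatrix πb i a).rank = Fintype.card U
  reward_distinct : ∀ i ≤ t, ∀ a, ∃ r, Function.Injective (M.rewProb πb i r a)

/-- Two models (possibly with different hidden states) induce the same law of the observable
data `z₋₁, z₀, a₀, r₀, …, z_N, a_N, r_N` under their behavior policies. -/
def SameObservables {U' : Type u} (N : ℕ) (M : POMDP U Z A ρ) (πb : HiddenPolicy U A)
    (M' : POMDP U' Z A ρ) (πb' : HiddenPolicy U' A) : Prop :=
  ∀ o : Z × (Fin (N + 1) → Z × A × ρ),
    M.prob (N := N) (πb.toPolicy Z) {τ | τ.obs = o} =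
      M'.prob (N := N) (πb'.toPolicy Z) {τ | τ.obs = o}

/-- Admissible projection matrices up to time `t`: `Mᵢₐ` has rank `|U|`, and so has its product with
the future–history matrix. -/
def Nondegenerate [Fintype U] [Fintype Z] [Fintype A] (M : POMDP U Z A ρ)
    (πb : HiddenPolicy U A) (t : Fin (N + 1))
    (L : (i : Fin (N + 1)) → A → Matrix (Fin (Fintype.card U)) (Fut Z A (N - i)) ℝ) : Prop :=
  ∀ i ≤ t, ∀ a, (L i a).rank = Fintype.card U ∧
    (L i a * M.futMatrix πb i a).rank = Fintype.card U

/-- The estimator of the probability that `r_t = r` under the evaluation policy `πe`: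
`∑ Π_e(τᵒ) P^b(r_t, z_t | a_t, H_{t-1}) M'_t · ∏_{i = t-1}^{0} (M_{i+1} P^b(F_{i+1}, z_i | a_i, H_{i-1} || a_{i+1}) M'_i) · M_0 P^b(F_0 || a_0)`
with `M'_i = (M_i P^b(F_i | a_i, H_{i-1}))⁺`; the factors of the product are ordered from
`i = t - 1` on the left to `i = 0` on the right. -/
noncomputable def estimator [Fintype U] [Fintype Z] [Fintype A] (M : POMDP U Z A ρ)
    (πb : HiddenPolicy U A) (πe : ObsPolicy Z A) (t : Fin (N + 1))
    (L : (i : Fin (N + 1)) → A → Matrix (Fin (Fintype.card U)) (Fut Z A (N - i)) ℝ)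
    (r : ρ) : ℝ :=
  let L' : (i : Fin (N + 1)) → A → Matrix (Hist Z A (i - 1)) (Fin (Fintype.card U)) ℝ :=
    fun i a => pinv (L i a * M.futMatrix πb i a)
  ∑ zs : Fin ((t : ℕ) + 1) → Z, ∑ as : Fin ((t : ℕ) + 1) → A,
    (∏ i : Fin ((t : ℕ) + 1), (πe i (prefixHist zs as i) (as i)).toReal) *
      ((M.rewRow πb t r (zs (Fin.last t)) (as (Fin.last t)) ᵥ* L' t (as (Fin.last t))) ⬝ᵥ
        ((List.ofFn fun i : Fin (t : ℕ) =>
            L (Fin.castLE t.is_le i).succ (as i.succ) *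
              M.doMatrix πb (Fin.castLE t.is_le i) (zs i.castSucc) (as i.castSucc) (as i.succ) *
              L' (Fin.castLE t.is_le i).castSucc (as i.castSucc)).reverse.prod *ᵥ
          (L 0 (as 0) *ᵥ M.doInit πb N (as 0))))

/-! ### The bordered moment matrices

The rows and columns are indexed by `Option`: `none` is the bordering row or column of marginals
(listed first), and `some` runs over all histories (futures) but one, `h₀` (`f₀`). -/

/-- The event that the proxy history at time `i` is the one indexed by `k`; no condition for
`none`. -/
def pastEvent (i : Fin (N + 1)) (h₀ : Hist Z A (i - 1)) (k : Option {h // h ≠ h₀}) :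
    Set (Traj U Z A ρ N) :=
  {τ | ∀ h ∈ k, τ.past i = h.1}

/-- The event that the future at time `i` is the one indexed by `k`; no condition for `none`. -/
def futEvent (i : Fin (N + 1)) (f₀ : Fut Z A (N - i)) (k : Option {f // f ≠ f₀}) :
    Set (Traj U Z A ρ N) :=
  {τ | ∀ f ∈ k, τ.fut i = f.1}

/-- The matrix `P` with entries `1`, `P^b(f | a)`, `P^b(h | a)`, `P^b(f, h | a)`. -/
noncomputable def momentP (M : POMDP U Z A ρ) (πb : HiddenPolicy U A) (i : Fin (N + 1)) (a : A)
    (h₀ : Hist Z A (i - 1)) (f₀ : Fut Z A (N - i)) :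
    Matrix (Option {h // h ≠ h₀}) (Option {f // f ≠ f₀}) ℝ :=
  Matrix.of fun k l => M.condProb (N := N) (πb.toPolicy Z)
    (pastEvent i h₀ k ∩ futEvent i f₀ l) {τ | τ.act i = a}

/-- The matrix `Q` with entries `P^b(r | a)`, `P^b(f, r | a)`, `P^b(h, r | a)`, `P^b(f, h, r | a)`. -/
noncomputable def momentQ (M : POMDP U Z A ρ) (πb : HiddenPolicy U A) (i : Fin (N + 1)) (a : A)
    (r : ρ) (h₀ : Hist Z A (i - 1)) (f₀ : Fut Z A (N - i)) :
    Matrix (Option {h // h ≠ h₀}) (Option {f // f ≠ f₀}) ℝ :=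
  Matrix.of fun k l => M.condProb (N := N) (πb.toPolicy Z)
    (pastEvent i h₀ k ∩ futEvent i f₀ l ∩ {τ | τ.rew i = r}) {τ | τ.act i = a}

/-- The matrix with rows `(1, P^b(f | s, a), …)`, where `s` runs over the hidden states. -/
noncomputable def momentU (M : POMDP U Z A ρ) (πb : HiddenPolicy U A) (i : Fin (N + 1)) (a : A)
    (f₀ : Fut Z A (N - i)) : Matrix U (Option {f // f ≠ f₀}) ℝ :=
  Matrix.of fun s l => M.condProb (N := N) (πb.toPolicy Z)
    (futEvent i f₀ l) {τ | τ.act i = a ∧ τ.st i = s}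

end POMDP

/-! ### Linear algebra -/

/-! Under a hidden-state policy, given the hidden state and the action at time i, the proxy history,
the reward and the future are independent; z_i counts as future, not as history. All observable laws
therefore factor through the hidden states (`prob_hidden`, `prob_succ`). Write B_i = P(F_i | a_i,
u_i) (`futKernel`), K_i = P(u_i | a_i, H_{i-1}) (`stateKernel`) and T_i = P(z_i, u_{i+1} | a_i, u_i)
(`obsTrans`). The future–history matrix is B_i K_i, and the interventional matrix is B_{i+1} T_i
K_i: the intervention removes the factor π_b(a_{i+1} | u_{i+1}) between B_{i+1} and T_i. The rank
assumption gives B_i a left inverse and K_i a right inverse, and makes every pair (hidden state,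
action) have positive probability (`Assumptions.pos`).

Estimator: C_i = M_i B_i is square and invertible, and K_i (C_i K_i)⁺ = C_i⁻¹. The matrix product
telescopes to T_{t-1} ⋯ T_0 applied to the law of u_0, paired with the emission and reward
probabilities at time t. The evaluation policy does not see the hidden states, so its probabilities
leave the sum over hidden paths, and P^e(r_t) is the same expression (`prob_rew_obs`).

Identification: for a fixed action let J = P(H_{i-1}, u_i, a_i = a) (`jointPast`) and let D be the
diagonal matrix of reward probabilities. The observable data determine J Bᵀ and J D Bᵀ. Two models
with the same products are related by a matrix G with D G = G D'; distinct entries of D leave one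
nonzero entry per column, and normalization makes G a permutation
(`Matrix.exists_equiv_of_factorizations`). The permutation does not depend on the action, because
the matrices J for different actions have proportional columns. Finally, the observable law of
(F_{i+1}, a_{i+1}, z_i) given (a_i, H_{i-1}) is B_{i+1} diag(π_b(a_{i+1} | ·)) T_i K_i. Cancelling
B_{i+1} and the positive diagonal gives T_i K_i up to a relabelling of rows, which cancels in
B_{i+1} T_i K_i.

Moments: P = S V and Q = S D V with S injective and V = `momentU`. Selecting columns gives (S V_Λ)⁺
S D V_Λ = V_Λ⁻¹ D V_Λ. -/

theorem Matrix.exists_right_inverse_of_rank_eq {m n : Type*} [Fintype m] [Fintype n]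
    [DecidableEq m] (W : Matrix m n ℝ) (h : W.rank = Fintype.card m) :
    ∃ X : Matrix n m ℝ, W * X = 1 := by
  rw [← Matrix.mulVec_surjective_iff_exists_right_inverse]
  have : LinearMap.range W.mulVecLin = ⊤ := by
    apply Submodule.eq_top_of_finrank_eq
    rw [Module.finrank_fintype_fun_eq_card]
    exact h
  exact LinearMap.range_eq_top.1 this

theorem Matrix.exists_left_inverse_of_rank_eq {m n : Type*} [Fintype m] [Fintype n]
    [DecidableEq n] (B : Matrix m n ℝ) (h : B.rank = Fintype.card n) :
    ∃ Y : Matrix n m ℝ, Y * B = 1 := by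
  obtain ⟨X, hX⟩ := Matrix.exists_right_inverse_of_rank_eq Bᵀ (by rw [Matrix.rank_transpose, h])
  exact ⟨Xᵀ, by rw [← Matrix.transpose_inj, Matrix.transpose_mul, Matrix.transpose_transpose, hX,
    Matrix.transpose_one]⟩

/-- The rank of a product is at most the rank of each factor, and neither factor can exceed the
inner dimension, so both attain it. -/
theorem Matrix.exists_inverses_of_rank_mul_eq {l m n : Type*} [Fintype l] [Fintype m] [Fintype n]
    [DecidableEq m] (B : Matrix l m ℝ) (W : Matrix m n ℝ) (h : (B * W).rank = Fintype.card m) :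
    (∃ Y : Matrix m l ℝ, Y * B = 1) ∧ ∃ X : Matrix n m ℝ, W * X = 1 :=
  ⟨B.exists_left_inverse_of_rank_eq (le_antisymm B.rank_le_card_width
    (h ▸ Matrix.rank_mul_le_left B W)),
   W.exists_right_inverse_of_rank_eq (le_antisymm W.rank_le_card_height
    (h ▸ Matrix.rank_mul_le_right B W))⟩

theorem pinv_mul_self_of_mul_eq_one {m n : Type*} [Fintype m] [Fintype n] [DecidableEq n]
    {X : Matrix m n ℝ} {Y : Matrix n m ℝ} (h : Y * X = 1) : pinv X * X = 1 := by
  calc pinv X * X = Y * X * (pinv X * X) := by rw [h, Matrix.one_mul]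
    _ = Y * (X * pinv X * X) := by simp only [Matrix.mul_assoc]
    _ = 1 := by rw [(pinv_spec X).mul_mul_self, h]

theorem mul_pinv_self_of_mul_eq_one {m n : Type*} [Fintype m] [Fintype n] [DecidableEq m]
    {X : Matrix m n ℝ} {Y : Matrix n m ℝ} (h : X * Y = 1) : X * pinv X = 1 := by
  calc X * pinv X = X * pinv X * (X * Y) := by rw [h, Matrix.mul_one]
    _ = X * pinv X * X * Y := by simp only [Matrix.mul_assoc]
    _ = 1 := by rw [(pinv_spec X).mul_mul_self, h]

/-- The product `C * W` has a right inverse, so its pseudoinverse is one too; multiplying `C * (W *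
pinv (C * W)) = 1` by `C'` isolates the claim. -/
theorem Matrix.mul_pinv_mul_eq {k m n : Type*} [Fintype k] [Fintype m] [Fintype n] [DecidableEq k]
    [DecidableEq m] {C : Matrix k m ℝ} {C' : Matrix m k ℝ} {W : Matrix m n ℝ} {X : Matrix n m ℝ}
    (h : C' * C = 1) (h' : C * C' = 1) (hX : W * X = 1) : W * pinv (C * W) = C' := by
  have h1 : C * W * (X * C') = 1 := by
    rw [Matrix.mul_assoc, ← Matrix.mul_assoc W, hX, Matrix.one_mul, h']
  have h2 := mul_pinv_self_of_mul_eq_one h1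
  calc W * pinv (C * W) = C' * C * (W * pinv (C * W)) := by rw [h, Matrix.one_mul]
    _ = C' * (C * W * pinv (C * W)) := by simp only [Matrix.mul_assoc]
    _ = C' := by rw [h2, Matrix.mul_one]

/-- Neighbouring factors meet in `C' i * C i = 1`. Reversal puts later times on the left, so the
induction peels off the leftmost factor. -/
theorem Matrix.prod_reverse_telescope {m n : Type*} [Fintype m] [Fintype n] [DecidableEq m]
    [DecidableEq n] (t : ℕ) (C : Fin (t + 1) → Matrix m n ℝ) (C' : Fin (t + 1) → Matrix n m ℝ)
    (T : Fin t → Matrix n n ℝ) (h : ∀ i, C' i * C i = 1) :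
    (List.ofFn fun i : Fin t => C i.succ * T i * C' i.castSucc).reverse.prod * C 0 =
      C (Fin.last t) * (List.ofFn T).reverse.prod := by
  induction t with
  | zero => simp
  | succ t ih =>
    rw [List.ofFn_succ', List.ofFn_succ', List.concat_eq_append, List.concat_eq_append,
      List.reverse_append, List.reverse_append]
    simp only [List.reverse_singleton, List.singleton_append, List.prod_cons, Fin.succ_last]
    have := ih (fun i => C i.castSucc) (fun i => C' i.castSucc) (fun i => T i.castSucc)
      fun i => h _
    simp only [Fin.castSucc_zero, Fin.castSucc_succ] at this
    rw [Matrix.mul_assoc, this]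
    rw [Matrix.mul_assoc (C (Fin.last t.succ) * T (Fin.last t)), ← Matrix.mul_assoc (C' _), h,
      Matrix.one_mul, Matrix.mul_assoc]

/-- Two simultaneous factorizations `J Bᵀ = J' B'ᵀ`, `J D Bᵀ = J' D' B'ᵀ` with `J, J', B, B'`
injective, `D` diagonal with distinct entries, `D'` diagonal, and columns of `B` and `B'` that sum
to one agree up to a relabelling of the columns. -/
theorem Matrix.exists_equiv_of_factorizations {F H n n' : Type*} [Fintype F] [Fintype H]
    [Fintype n] [Fintype n'] [DecidableEq n] [DecidableEq n']
    (J : Matrix H n ℝ) (J' : Matrix H n' ℝ) (B : Matrix F n ℝ) (B' : Matrix F n' ℝ)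
    (d : n → ℝ) (d' : n' → ℝ) (hd : Function.Injective d)
    {X : Matrix n H ℝ} (hX : X * J = 1) {X' : Matrix n' H ℝ} (hX' : X' * J' = 1)
    {Y : Matrix n F ℝ} (hY : Y * B = 1) {Y' : Matrix n' F ℝ} (hY' : Y' * B' = 1)
    (h1 : J * Bᵀ = J' * B'ᵀ)
    (h2 : J * Matrix.diagonal d * Bᵀ = J' * Matrix.diagonal d' * B'ᵀ)
    (hB : ∀ s, ∑ f, B f s = 1) (hB' : ∀ s, ∑ f, B' f s = 1) :
    ∃ τ : n' ≃ n, (∀ h s, J' h s = J h (τ s)) ∧ ∀ f s, B' f s = B f (τ s) := by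
  have hYt : Bᵀ * Yᵀ = 1 := by rw [← Matrix.transpose_mul, hY, Matrix.transpose_one]
  have hYt' : B'ᵀ * Y'ᵀ = 1 := by rw [← Matrix.transpose_mul, hY', Matrix.transpose_one]
  -- `G` is the transition between the models: `J' = J * G` and `Bᵀ = G * B'ᵀ`. It will turn out to
  -- be a permutation matrix.
  set G := X * J' with hG
  have hBG : Bᵀ = G * B'ᵀ := by
    rw [hG, Matrix.mul_assoc, ← h1, ← Matrix.mul_assoc, hX, Matrix.one_mul]
  have hJG : J' = J * G := by
    calc J' = J' * B'ᵀ * Y'ᵀ := by rw [Matrix.mul_assoc, hYt', Matrix.mul_one]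
      _ = J * (G * B'ᵀ) * Y'ᵀ := by rw [← h1, ← hBG]
      _ = J * G * (B'ᵀ * Y'ᵀ) := by simp only [Matrix.mul_assoc]
      _ = J * G := by rw [hYt', Matrix.mul_one]
  have hDG : Matrix.diagonal d * G = G * Matrix.diagonal d' := by
    have h3 : Matrix.diagonal d * (G * B'ᵀ) = G * Matrix.diagonal d' * B'ᵀ := by
      calc Matrix.diagonal d * (G * B'ᵀ) = X * J * Matrix.diagonal d * Bᵀ := by
            rw [hX, Matrix.one_mul, ← hBG]
        _ = X * (J * Matrix.diagonal d * Bᵀ) := by simp only [Matrix.mul_assoc]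
        _ = X * J * G * Matrix.diagonal d' * B'ᵀ := by
            rw [h2, hJG]; simp only [Matrix.mul_assoc]
        _ = _ := by rw [hX, Matrix.one_mul]
    calc Matrix.diagonal d * G = Matrix.diagonal d * (G * B'ᵀ) * Y'ᵀ := by
          rw [Matrix.mul_assoc, Matrix.mul_assoc G, hYt', Matrix.mul_one]
      _ = G * Matrix.diagonal d' * (B'ᵀ * Y'ᵀ) := by rw [h3, Matrix.mul_assoc]
      _ = _ := by rw [hYt', Matrix.mul_one]
  -- Entrywise, `D G = G D'` matches diagonal values wherever `G` is nonzero. As `d` is injective,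
  -- each column of `G` has at most one nonzero entry; the left inverse `X' * J` gives at least one.
  have hent : ∀ s s', G s s' ≠ 0 → d s = d' s' := by
    intro s s' hne
    have := congrFun (congrFun hDG s) s'
    rw [Matrix.diagonal_mul, Matrix.mul_diagonal, mul_comm] at this
    exact mul_left_cancel₀ hne this
  have hX'J : X' * J * G = 1 := by rw [Matrix.mul_assoc, ← hJG, hX']
  have hcol : ∀ s', ∃ s, G s s' ≠ 0 := by
    intro s'
    by_contra! hc
    have := congrFun (congrFun hX'J s') s'
    rw [Matrix.mul_apply] at this
    simp [hc] at this
  choose τ hτ using hcol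
  have hzero : ∀ s s', s ≠ τ s' → G s s' = 0 := by
    intro s s' hne
    by_contra hc
    exact hne (hd ((hent s s' hc).trans (hent _ _ (hτ s')).symm))
  -- Two columns of `G` supported in the same row would be proportional, which the left inverse
  -- excludes.
  have hinj : Function.Injective τ := by
    intro s₁ s₂ h12
    by_contra hne
    have e1 := congrFun (congrFun hX'J s₁) s₁
    have e2 := congrFun (congrFun hX'J s₁) s₂
    rw [Matrix.mul_apply, Finset.sum_eq_single (τ s₁) (fun b _ hb => by rw [hzero _ _ hb, mul_zero])
      (by simp), Matrix.one_apply_eq] at e1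
    rw [Matrix.mul_apply, Finset.sum_eq_single (τ s₂) (fun b _ hb => by rw [hzero _ _ hb, mul_zero])
      (by simp), Matrix.one_apply_ne hne, ← h12] at e2
    rcases mul_eq_zero.1 e2 with h0 | h0
    · rw [h0, zero_mul] at e1
      exact zero_ne_one e1
    · exact hτ s₂ (h12 ▸ h0)
  -- A row of `G` outside the range of `τ` vanishes, and with it a column of `B`, whose entries sum
  -- to one.
  have hsurj : Function.Surjective τ := by
    intro s
    by_contra! hc
    have : ∀ f, B f s = 0 := by
      intro f
      have := congrFun (congrFun hBG s) f
      rw [Matrix.transpose_apply, Matrix.mul_apply] at this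
      rw [this]
      exact Finset.sum_eq_zero fun s' _ => by rw [hzero s s' (hc s').symm, zero_mul]
    have h3 := hB s
    simp [this] at h3
  have hBτ : ∀ f s', B f (τ s') = G (τ s') s' * B' f s' := by
    intro f s'
    have := congrFun (congrFun hBG (τ s')) f
    rw [Matrix.transpose_apply, Matrix.mul_apply, Finset.sum_eq_single s'
      (fun b _ hb => by rw [hzero _ _ fun h => hb (hinj h).symm, zero_mul]) (by simp)] at this
    exact this
  -- Corresponding columns of `B` and `B'` differ by this scalar and both sum to one.
  have hone : ∀ s', G (τ s') s' = 1 := by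
    intro s'
    have h3 := hB (τ s')
    simp only [hBτ, ← Finset.mul_sum, hB', mul_one] at h3
    exact h3
  refine ⟨Equiv.ofBijective τ ⟨hinj, hsurj⟩, fun h s => ?_, fun f s => ?_⟩
  · rw [hJG, Matrix.mul_apply, Finset.sum_eq_single (τ s)
      (fun b _ hb => by rw [hzero _ _ hb, mul_zero]) (by simp), hone, mul_one]
    rfl
  · change B' f s = B f (τ s)
    rw [hBτ, hone, one_mul]

/-- The columns of `P * V` are the images of those of `V` under `P`, which is injective because it
has a left inverse. -/
theorem Matrix.linearIndependent_mul_col_iff {H n F ι : Type*} [Fintype H] [Fintype n]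
    [DecidableEq n] {P : Matrix H n ℝ} {X : Matrix n H ℝ} (hX : X * P = 1) (V : Matrix n F ℝ)
    (Λ : ι → F) : (LinearIndependent ℝ fun j => (P * V).col (Λ j)) ↔
      LinearIndependent ℝ fun j => V.col (Λ j) := by
  have h1 : (fun j => (P * V).col (Λ j)) = P.mulVecLin ∘ fun j => V.col (Λ j) := by
    funext j h
    simp [Matrix.mul_apply, Matrix.mulVec, dotProduct]
  have hinj : Function.Injective P.mulVecLin := by
    intro a b hab
    simp only [Matrix.mulVecLin_apply] at hab
    have := congrArg (X *ᵥ ·) hab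
    simpa [Matrix.mulVec_mulVec, hX] using this
  rw [h1, P.mulVecLin.linearIndependent_iff (LinearMap.ker_eq_bot.2 hinj)]

/-- A matrix with a right inverse has a maximal family of linearly independent columns that
includes a given nonzero column. -/
theorem Matrix.exists_linearIndependent_col {n F : Type*} [Fintype n] [DecidableEq n]
    [Fintype F] (V : Matrix n F ℝ) {X : Matrix F n ℝ} (hX : V * X = 1) (l : F)
    (hl : V.col l ≠ 0) : ∃ Λ : Fin (Fintype.card n) → F, l ∈ Set.range Λ ∧
      LinearIndependent ℝ fun j => V.col (Λ j) := by
  have h0 : LinearIndepOn ℝ V.col {l} := by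
    rw [linearIndepOn_singleton_iff]; exact hl
  obtain ⟨b, -, hlb, hspan, hb⟩ := exists_linearIndepOn_extension h0 (Set.subset_univ _)
  have htop : Submodule.span ℝ (Set.range fun j : b => V.col j) = ⊤ := by
    have h1 : Submodule.span ℝ (Set.range V.col) = ⊤ := by
      rw [← Matrix.range_mulVecLin, LinearMap.range_eq_top]
      exact Matrix.mulVec_surjective_iff_exists_right_inverse.2 ⟨X, hX⟩
    rw [eq_top_iff, ← h1, Submodule.span_le, ← Set.image_univ]
    rw [← Set.image_eq_range]
    exact hspan
  have : Fintype b := Fintype.ofFinite b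
  have hcard : Fintype.card b = Fintype.card n := by
    rw [← Module.finrank_fintype_fun_eq_card ℝ (η := n), ← finrank_top, ← htop]
    exact (finrank_span_eq_card hb).symm
  let e : Fin (Fintype.card n) ≃ b := (Fintype.equivFinOfCardEq hcard).symm
  refine ⟨fun j => e j, ⟨e.symm ⟨l, hlb rfl⟩, by simp⟩, ?_⟩
  exact hb.linearIndependent.comp e e.injective

/-- The eigendecomposition of `(P L(Λ))⁺ Q L(Λ)` for `P = S V` and `Q = S D V`. -/
theorem Matrix.pinv_mul_submatrix {H n F k : Type*} [Fintype H] [Fintype n] [Fintype k]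
    [DecidableEq n] [DecidableEq k] {S : Matrix H n ℝ} {X : Matrix n H ℝ} (hX : X * S = 1)
    (V : Matrix n F ℝ) (d : n → ℝ) (Λ : k → F) (e : k ≃ n)
    (hu : LinearIndependent ℝ fun j => V.col (Λ j)) :
    IsUnit (V.submatrix e Λ) ∧
      pinv ((S * V).submatrix id Λ) * (S * Matrix.diagonal d * V).submatrix id Λ =
        (V.submatrix e Λ)⁻¹ * Matrix.diagonal (fun j => d (e j)) * V.submatrix e Λ := by
  have hunit : IsUnit (V.submatrix e Λ) := by
    rw [← Matrix.linearIndependent_cols_iff_isUnit]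
    have h1 : (V.submatrix e Λ).col = (LinearEquiv.funCongrLeft ℝ ℝ e).toLinearMap ∘
        fun j => V.col (Λ j) := by
      funext j i; rfl
    rw [h1, LinearMap.linearIndependent_iff _ (LinearEquiv.ker _)]
    exact hu
  refine ⟨hunit, ?_⟩
  set Ve := V.submatrix e Λ
  have hdet := (Matrix.isUnit_iff_isUnit_det _).1 hunit
  have e1 : (S * V).submatrix id Λ = S.submatrix id e * Ve :=
    (Matrix.submatrix_mul_equiv S V id e Λ).symm
  have e2 : (S * Matrix.diagonal d * V).submatrix id Λ =
      S.submatrix id e * Matrix.diagonal (fun j => d (e j)) * Ve := by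
    rw [← Matrix.submatrix_mul_equiv _ V id e Λ, ← Matrix.submatrix_mul_equiv S _ id e e,
      Matrix.submatrix_diagonal_equiv]
    rfl
  have hXe : X.submatrix e id * S.submatrix id e = 1 := by
    rw [Matrix.submatrix_mul _ _ e id e Function.bijective_id |>.symm, hX,
      Matrix.submatrix_one_equiv]
  have hinv : Ve⁻¹ * X.submatrix e id * (S.submatrix id e * Ve) = 1 := by
    rw [Matrix.mul_assoc, ← Matrix.mul_assoc _ _ Ve, hXe, Matrix.one_mul,
      Matrix.nonsing_inv_mul _ hdet]
  have hp := pinv_mul_self_of_mul_eq_one hinv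
  rw [e1, e2]
  set W := pinv (S.submatrix id e * Ve)
  -- The pseudoinverse is a left inverse of the product, and the square factor `Ve` can be moved to
  -- the other side.
  have hW : W * S.submatrix id e = Ve⁻¹ := by
    calc W * S.submatrix id e = W * (S.submatrix id e * Ve) * Ve⁻¹ := by
          rw [Matrix.mul_assoc, Matrix.mul_assoc, Matrix.mul_nonsing_inv _ hdet, Matrix.mul_one]
      _ = Ve⁻¹ := by rw [hp, Matrix.one_mul]
  rw [← Matrix.mul_assoc, ← Matrix.mul_assoc, hW]

/-! ### Splitting trajectories in time -/

namespace POMDP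

open scoped ENNReal

variable {U : Type u} {Z : Type v} {A : Type w} {ρ : Type x} {N : ℕ}

/-- What happens in one time step: the hidden state, the observation, the action, the reward. -/
abbrev Step (U : Type u) (Z : Type v) (A : Type w) (ρ : Type x) := U × Z × A × ρ

/-- Splitting off the last entry of a finite sequence. -/
def snocEquiv (S : Type*) (n : ℕ) : (Fin n → S) × S ≃ (Fin (n + 1) → S) where
  toFun p := Fin.snoc p.1 p.2
  invFun f := (Fin.init f, f (Fin.last n))
  left_inv p := by simp
  right_inv f := by simp

theorem tsum_snoc {S : Type*} {n : ℕ} (f : (Fin (n + 1) → S) → ℝ≥0∞) :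
    ∑' y, f y = ∑' s, ∑' y : Fin n → S, f (Fin.snoc y s) := by
  rw [← (snocEquiv S n).tsum_eq, ENNReal.tsum_prod', ENNReal.tsum_comm]
  rfl

theorem sum_snoc {S : Type*} [Fintype S] {R : Type*} [AddCommMonoid R] {n : ℕ}
    (f : (Fin (n + 1) → S) → R) :
    ∑ y, f y = ∑ s, ∑ y : Fin n → S, f (Fin.snoc y s) := by
  rw [← (snocEquiv S n).sum_comp, Fintype.sum_prod_type, Finset.sum_comm]
  rfl

/-- Trajectories as sequences of steps. -/
def stepsEquiv (U : Type u) (Z : Type v) (A : Type w) (ρ : Type x) (N : ℕ) :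
    Z × (Fin (N + 1) → Step U Z A ρ) ≃ Traj U Z A ρ N where
  toFun p := ⟨p.1, fun i => (p.2 i).1, fun i => (p.2 i).2.1, fun i => (p.2 i).2.2.1,
    fun i => (p.2 i).2.2.2⟩
  invFun τ := (τ.zpre, fun i => (τ.st i, τ.ob i, τ.act i, τ.rew i))
  left_inv _ := rfl
  right_inv _ := rfl

/-- The positions of a sequence before, at, and after the position `i`. -/
def splitIndex (i : Fin (N + 1)) : Fin i ⊕ Unit ⊕ Fin (N - i) ≃ Fin (N + 1) where
  toFun s := match s with
    | .inl k => ⟨k, by omega⟩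
    | .inr (.inl _) => i
    | .inr (.inr k) => ⟨i + 1 + k, by omega⟩
  invFun j := if h : (j : ℕ) < i then .inl ⟨j, h⟩
    else if h' : (j : ℕ) = i then .inr (.inl ()) else .inr (.inr ⟨j - (i + 1), by omega⟩)
  left_inv s := by
    rcases s with k | _ | k
    · simp
    · simp
    · simp [show ¬ ((i : ℕ) + 1 + k < i) by omega, show ¬ ((i : ℕ) + 1 + k = i) by omega]
  right_inv j := by
    by_cases h : (j : ℕ) < i
    · simp [h]
    · by_cases h' : (j : ℕ) = i
      · simp [h', Fin.ext_iff]
      · simp [h, h', Fin.ext_iff]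
        omega

/-- Splitting a sequence into the parts before, at, and after the position `i`. -/
def splitSeq (S : Type*) (i : Fin (N + 1)) :
    (Fin (N + 1) → S) ≃ (Fin i → S) × S × (Fin (N - i) → S) where
  toFun x := (fun k => x (splitIndex i (.inl k)), x i, fun k => x (splitIndex i (.inr (.inr k))))
  invFun p j := Sum.elim p.1 (Sum.elim (fun _ => p.2.1) p.2.2) ((splitIndex i).symm j)
  left_inv x := by
    funext j
    obtain ⟨s, rfl⟩ := (splitIndex i).surjective j
    simp only [Equiv.symm_apply_apply]
    rcases s with k | _ | k <;> rfl
  right_inv p := by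
    have h : (splitIndex i).symm i = .inr (.inl ()) := by
      rw [Equiv.symm_apply_eq]; rfl
    simp [h]

theorem prod_split {R : Type*} [CommMonoid R] (i : Fin (N + 1)) (g : Fin (N + 1) → R) :
    ∏ j, g j = (∏ k : Fin i, g ⟨k, by omega⟩) * g i *
      ∏ k : Fin (N - i), g ⟨i + 1 + k, by omega⟩ := by
  rw [← (splitIndex i).prod_comp, Fintype.prod_sum_type, Fintype.prod_sum_type, mul_assoc]
  simp [splitIndex]

theorem prod_split_castSucc {R : Type*} [CommMonoid R] (i : Fin (N + 1)) (g : Fin N → R) :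
    ∏ j, g j = (∏ k : Fin i, g ⟨k, by omega⟩) * ∏ k : Fin (N - i), g ⟨i + k, by omega⟩ := by
  have h : (i : ℕ) + (N - i) = N := by omega
  rw [← (finCongr h).prod_comp, Fin.prod_univ_add]
  rfl

/-- The probabilities of a step at time `n`, given the hidden state, if the action `a` has weight
`q n s a` in the hidden state `s`. -/
noncomputable def stepWeight (M : POMDP U Z A ρ) (q : ℕ → U → A → ℝ≥0∞) (n : ℕ)
    (s : Step U Z A ρ) : ℝ≥0∞ :=
  M.emit s.1 s.2.1 * q n s.1 s.2.2.1 * M.reward s.1 s.2.2.1 s.2.2.2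

/-- The hidden state at time `j` if the first `k` steps are `y` and the next hidden state is `s`. -/
def stateAt {k : ℕ} (y : Fin k → Step U Z A ρ) (s : U) (j : ℕ) : U :=
  if h : j < k then (y ⟨j, h⟩).1 else s

/-- The probability of starting with `z` and the steps `y` and then arriving at `s`. -/
noncomputable def prefixWeight (M : POMDP U Z A ρ) (q : ℕ → U → A → ℝ≥0∞) {k : ℕ} (z : Z)
    (y : Fin k → Step U Z A ρ) (s : U) : ℝ≥0∞ :=
  M.init (stateAt y s 0) * M.pre (stateAt y s 0) z *
    ∏ j : Fin k, (M.stepWeight q j (y j) * M.trans (y j).1 (y j).2.2.1 (stateAt y s (j + 1)))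

/-- The hidden state and the action preceding the `j`-th of the steps `w` that come after `(s, a)`. -/
def pairBefore {m : ℕ} (s : U) (a : A) (w : Fin m → Step U Z A ρ) (j : Fin m) : U × A :=
  if (j : ℕ) = 0 then (s, a) else
    ((w ⟨j - 1, by omega⟩).1, (w ⟨j - 1, by omega⟩).2.2.1)

/-- The probability of the steps `w`, starting at time `k`, if the preceding hidden state and
action are `s` and `a`. -/
noncomputable def tailWeight (M : POMDP U Z A ρ) (q : ℕ → U → A → ℝ≥0∞) (k : ℕ) {m : ℕ} (s : U)
    (a : A) (w : Fin m → Step U Z A ρ) : ℝ≥0∞ :=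
  ∏ j : Fin m, (M.stepWeight q (k + j) (w j) *
    M.trans (pairBefore s a w j).1 (pairBefore s a w j).2 (w j).1)

/-- The weight of a trajectory in which actions are weighted by `q`. -/
noncomputable def pathWeight (M : POMDP U Z A ρ) (q : ℕ → U → A → ℝ≥0∞) (τ : Traj U Z A ρ N) :
    ℝ≥0∞ :=
  M.init (τ.st 0) * M.pre (τ.st 0) τ.zpre *
    (∏ i : Fin (N + 1), M.stepWeight q i (τ.st i, τ.ob i, τ.act i, τ.rew i)) *
    ∏ i : Fin N, M.trans (τ.st i.castSucc) (τ.act i.castSucc) (τ.st i.succ)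

/-- The action weights of a hidden policy. -/
noncomputable def actionWeight (π : HiddenPolicy U A) : ℕ → U → A → ℝ≥0∞ := fun n s a => π n s a

theorem weight_hidden (M : POMDP U Z A ρ) (π : HiddenPolicy U A) (τ : Traj U Z A ρ N) :
    M.weight (π.toPolicy Z) τ = M.pathWeight (actionWeight π) τ := rfl

theorem weight_obs (M : POMDP U Z A ρ) (π : ObsPolicy Z A) (τ : Traj U Z A ρ N) :
    M.weight (π.toPolicy U) τ =
      (∏ i : Fin (N + 1), π i (prefixHist τ.ob τ.act i) (τ.act i)) *
        M.pathWeight (fun _ _ _ => 1) τ := by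
  simp only [weight, pathWeight, ObsPolicy.toPolicy, stepWeight, Finset.prod_mul_distrib,
    Finset.prod_const_one]
  ring

/-- The weight of a trajectory factorizes at each time `i`. -/
theorem pathWeight_split (M : POMDP U Z A ρ) (q : ℕ → U → A → ℝ≥0∞) (i : Fin (N + 1)) (z : Z)
    (x : Fin (N + 1) → Step U Z A ρ) :
    M.pathWeight q (stepsEquiv U Z A ρ N (z, x)) =
      M.prefixWeight q z (splitSeq _ i x).1 (splitSeq _ i x).2.1.1 *
        M.stepWeight q i (splitSeq _ i x).2.1 *
        M.tailWeight q (i + 1) (splitSeq _ i x).2.1.1 (splitSeq _ i x).2.1.2.2.1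
          (splitSeq _ i x).2.2 := by
  have hst : ∀ j (hj : j ≤ (i : ℕ)), stateAt (splitSeq _ i x).1 (splitSeq _ i x).2.1.1 j
      = (x ⟨j, by omega⟩).1 := by
    intro j hj
    unfold stateAt
    split_ifs with h
    · rfl
    · have : i = ⟨j, by omega⟩ := Fin.ext (by simp; omega)
      simp [splitSeq, ← this]
  have hpair : ∀ j : Fin (N - i), pairBefore (splitSeq _ i x).2.1.1 (splitSeq _ i x).2.1.2.2.1
      (splitSeq _ i x).2.2 j = ((x ⟨i + j, by omega⟩).1, (x ⟨i + j, by omega⟩).2.2.1) := by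
    intro j
    unfold pairBefore
    split_ifs with h
    · have : i = ⟨i + j, by omega⟩ := Fin.ext (by simp; omega)
      simp [splitSeq, ← this]
    · have : (⟨i + j, by omega⟩ : Fin (N + 1)) = ⟨i + 1 + (j - 1), by omega⟩ :=
        Fin.ext (by simp; omega)
      rw [this]
      rfl
  unfold pathWeight prefixWeight tailWeight
  simp only [hpair]
  rw [hst 0 (Nat.zero_le _), prod_split i, prod_split_castSucc i, Finset.prod_mul_distrib,
    Finset.prod_mul_distrib]
  have h1 : ∏ j : Fin i, M.trans ((splitSeq _ i x).1 j).1 ((splitSeq _ i x).1 j).2.2.1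
      (stateAt (splitSeq _ i x).1 (splitSeq _ i x).2.1.1 (j + 1))
      = ∏ j : Fin i, M.trans (x ⟨j, by omega⟩).1 (x ⟨j, by omega⟩).2.2.1
        (x ⟨j + 1, by omega⟩).1 := by
    refine Finset.prod_congr rfl fun j _ => ?_
    rw [hst _ (by omega)]
    rfl
  have h2 : ∏ j : Fin (N - i), M.trans (x ⟨i + j, by omega⟩).1 (x ⟨i + j, by omega⟩).2.2.1
      ((splitSeq _ i x).2.2 j).1 = ∏ j : Fin (N - i), M.trans (x ⟨i + j, by omega⟩).1
        (x ⟨i + j, by omega⟩).2.2.1 (x ⟨i + j + 1, by omega⟩).1 := by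
    refine Finset.prod_congr rfl fun j _ => ?_
    have : (⟨i + j + 1, by omega⟩ : Fin (N + 1)) = ⟨i + 1 + j, by omega⟩ :=
        Fin.ext (by simp; omega)
    rw [this]
    rfl
  rw [h1, h2]
  simp only [stepsEquiv, splitSeq, splitIndex, Equiv.coe_fn_mk, Fin.castSucc_mk, Fin.succ_mk,
    Fin.zero_eta]
  ring

/-- The Markov recursion of the forward weight: the shorter prefix arrives at the hidden state of
the appended step. -/
theorem prefixWeight_snoc (M : POMDP U Z A ρ) (q : ℕ → U → A → ℝ≥0∞) {k : ℕ} (z : Z)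
    (y : Fin k → Step U Z A ρ) (s : Step U Z A ρ) (s' : U) :
    M.prefixWeight q z (Fin.snoc (α := fun _ => Step U Z A ρ) y s : Fin (k + 1) → _) s' =
      M.prefixWeight q z y s.1 * M.stepWeight q k s * M.trans s.1 s.2.2.1 s' := by
  have hst : ∀ j, j ≤ k → stateAt (Fin.snoc (α := fun _ => Step U Z A ρ) y s : Fin (k + 1) → _) s' j
      = stateAt y s.1 j := by
    intro j hj
    unfold stateAt
    rw [dif_pos (by omega)]
    split_ifs with h
    · simp [Fin.snoc, h]
    · simp [Fin.snoc, h]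
  have hlast : stateAt (Fin.snoc (α := fun _ => Step U Z A ρ) y s : Fin (k + 1) → _) s' (k + 1)
      = s' := by simp [stateAt]
  unfold prefixWeight
  rw [Fin.prod_univ_castSucc, hst 0 (Nat.zero_le _)]
  simp only [Fin.snoc_castSucc, Fin.snoc_last, Fin.val_last, hlast, Fin.val_castSucc]
  rw [Finset.prod_congr rfl fun (j : Fin k) _ => by rw [hst (j + 1) (by omega)]]
  ring

/-- The preceding pair `p` is left unspecified: summing out the last step uses only that it does not
depend on `b`. -/
theorem exists_tailWeight_snoc (M : POMDP U Z A ρ) (q : ℕ → U → A → ℝ≥0∞) (k : ℕ) {m : ℕ} (s : U)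
    (a : A) (w : Fin m → Step U Z A ρ) :
    ∃ p : U × A, ∀ b : Step U Z A ρ, M.tailWeight q k s a
      (Fin.snoc (α := fun _ => Step U Z A ρ) w b : Fin (m + 1) → _) =
      M.tailWeight q k s a w * (M.stepWeight q (k + m) b * M.trans p.1 p.2 b.1) := by
  refine ⟨if h : m = 0 then (s, a) else ((w ⟨m - 1, by omega⟩).1, (w ⟨m - 1, by omega⟩).2.2.1),
    fun b => ?_⟩
  have h1 : ∀ j, pairBefore s a (Fin.snoc (α := fun _ => Step U Z A ρ) w b : Fin (m + 1) → _)
      (Fin.castSucc j) = pairBefore s a w j := by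
    intro j
    have : (j : ℕ) - 1 < m := by omega
    simp [pairBefore, Fin.snoc, this]
  have h2 : pairBefore s a (Fin.snoc (α := fun _ => Step U Z A ρ) w b : Fin (m + 1) → _)
      (Fin.last m) =
      if h : m = 0 then (s, a) else ((w ⟨m - 1, by omega⟩).1, (w ⟨m - 1, by omega⟩).2.2.1) := by
    unfold pairBefore
    by_cases h : m = 0
    · simp [h]
    · have : m - 1 < m := by omega
      simp [Fin.snoc, this, h]
  unfold tailWeight
  rw [Fin.prod_univ_castSucc, ← h2]
  simp only [Fin.snoc_castSucc, Fin.snoc_last, Fin.val_last, Fin.val_castSucc, h1]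

end POMDP

/-! ### Marginals of trajectory weights -/

namespace POMDP

open scoped ENNReal

variable {U : Type u} {Z : Type v} {A : Type w} {ρ : Type x} {N : ℕ}

/-- Action weights that sum to one in each hidden state. -/
def IsNormalized (q : ℕ → U → A → ℝ≥0∞) : Prop := ∀ n s, ∑' a, q n s a = 1

theorem isNormalized_actionWeight (π : HiddenPolicy U A) : IsNormalized (actionWeight π) :=
  fun n s => (π n s).tsum_coe

theorem tsum_step (f : Step U Z A ρ → ℝ≥0∞) :
    ∑' b, f b = ∑' s, ∑' z, ∑' a, ∑' r, f (s, z, a, r) := by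
  simp only [ENNReal.tsum_prod']

/-- For a fixed hidden state the reward sums out before the action, on which its law depends, and
then the action and the observation sum to one. -/
theorem tsum_stepWeight (M : POMDP U Z A ρ) {q : ℕ → U → A → ℝ≥0∞} (hq : IsNormalized q) (n : ℕ)
    (g : U → ℝ≥0∞) : ∑' b : Step U Z A ρ, M.stepWeight q n b * g b.1 = ∑' s, g s := by
  rw [tsum_step]
  refine tsum_congr fun s => ?_
  simp only [stepWeight, ENNReal.tsum_mul_right, ENNReal.tsum_mul_left, PMF.tsum_coe, mul_one,
    hq n s, one_mul]

theorem tsum_tailWeight (M : POMDP U Z A ρ) {q : ℕ → U → A → ℝ≥0∞} (hq : IsNormalized q) (k m : ℕ)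
    (s : U) (a : A) : ∑' w : Fin m → Step U Z A ρ, M.tailWeight q k s a w = 1 := by
  induction m with
  | zero => simp [tailWeight]
  | succ m ih =>
    rw [tsum_snoc, ENNReal.tsum_comm, ← ih]
    refine tsum_congr fun w => ?_
    obtain ⟨p, hp⟩ := M.exists_tailWeight_snoc q k s a w
    simp only [hp, ENNReal.tsum_mul_left]
    rw [M.tsum_stepWeight hq (k + m) (fun s => M.trans p.1 p.2 s), PMF.tsum_coe, mul_one]

/-- The last transition sums to one over the end state. The last step then reduces to its hidden
state, which is the end state of the shorter prefix. -/
theorem tsum_prefixWeight (M : POMDP U Z A ρ) {q : ℕ → U → A → ℝ≥0∞} (hq : IsNormalized q)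
    (k : ℕ) :
    ∑' (s : U) (z : Z) (y : Fin k → Step U Z A ρ), M.prefixWeight q z y s = 1 := by
  induction k with
  | zero => simp [prefixWeight, stateAt, ENNReal.tsum_mul_left]
  | succ k ih =>
    calc ∑' (s : U) (z : Z) (y : Fin (k + 1) → Step U Z A ρ), M.prefixWeight q z y s
        = ∑' (z : Z) (y : Fin (k + 1) → Step U Z A ρ) (s : U), M.prefixWeight q z y s := by
          rw [ENNReal.tsum_comm]
          exact tsum_congr fun z => ENNReal.tsum_comm
      _ = ∑' (z : Z) (b : Step U Z A ρ) (y : Fin k → Step U Z A ρ),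
            M.stepWeight q k b * M.prefixWeight q z y b.1 := by
          refine tsum_congr fun z => ?_
          rw [tsum_snoc]
          refine tsum_congr fun b => tsum_congr fun y => ?_
          simp only [prefixWeight_snoc, ENNReal.tsum_mul_left, PMF.tsum_coe, mul_one]
          ring
      _ = ∑' (z : Z) (s : U) (y : Fin k → Step U Z A ρ), M.prefixWeight q z y s := by
          refine tsum_congr fun z => ?_
          simp only [ENNReal.tsum_mul_left]
          exact M.tsum_stepWeight hq k fun s => ∑' y : Fin k → Step U Z A ρ, M.prefixWeight q z y s
      _ = 1 := by rw [ENNReal.tsum_comm, ih]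

/-- Splitting at the last time leaves an empty tail and reduces the claim to the prefix weights. -/
theorem tsum_pathWeight (M : POMDP U Z A ρ) {q : ℕ → U → A → ℝ≥0∞} (hq : IsNormalized q) :
    ∑' τ : Traj U Z A ρ N, M.pathWeight q τ = 1 := by
  rw [← (stepsEquiv U Z A ρ N).tsum_eq, ENNReal.tsum_prod', ← M.tsum_prefixWeight hq N,
    ENNReal.tsum_comm (α := U)]
  refine tsum_congr fun z => ?_
  simp only [M.pathWeight_split q (Fin.last N)]
  rw [← (splitSeq (Step U Z A ρ) (Fin.last N)).symm.tsum_eq, ENNReal.tsum_comm (α := U),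
    ENNReal.tsum_prod']
  refine tsum_congr fun y => ?_
  simp only [Equiv.apply_symm_apply]
  rw [ENNReal.tsum_prod']
  simp only [ENNReal.tsum_mul_left, M.tsum_tailWeight hq, mul_one]
  exact (tsum_congr fun b => mul_comm _ _).trans
    (M.tsum_stepWeight hq N fun s => M.prefixWeight q z y s)

/-- The proxy history determined by the initial observation and the first `k` steps. -/
def pastOf {k : ℕ} (p : Z × (Fin k → Step U Z A ρ)) : Hist Z A (k - 1) :=
  (fun j => if h : k = 0 then p.1 else (p.2 ⟨j, by omega⟩).2.1,
    fun j => (p.2 ⟨j, by omega⟩).2.2.1)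

theorem past_stepsEquiv (i : Fin (N + 1)) (z : Z) (x : Fin (N + 1) → Step U Z A ρ) :
    (stepsEquiv U Z A ρ N (z, x)).past i = pastOf (z, (splitSeq _ i x).1) := by
  unfold Traj.past pastOf
  refine Prod.ext (funext fun j => ?_) rfl
  by_cases h : (i : ℕ) = 0
  · simp [h, stepsEquiv]
  · simp only [h]
    rfl

/-- The observable part of the last steps of a trajectory. -/
def obsTail {m : ℕ} (w : Fin m → Step U Z A ρ) : Fin m → Z × A :=
  fun j => ((w j).2.1, (w j).2.2.1)

theorem fut_stepsEquiv (i : Fin (N + 1)) (z : Z) (x : Fin (N + 1) → Step U Z A ρ) :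
    (stepsEquiv U Z A ρ N (z, x)).fut i =
      ((splitSeq _ i x).2.1.2.1, obsTail (splitSeq _ i x).2.2) := rfl

/-- The probability that the initial part of a trajectory lies in `H` and that the next hidden
state is `s`. -/
noncomputable def fwd (M : POMDP U Z A ρ) (q : ℕ → U → A → ℝ≥0∞) {k : ℕ}
    (H : Set (Z × (Fin k → Step U Z A ρ))) (s : U) : ℝ≥0∞ :=
  ∑' p, H.indicator (fun p => M.prefixWeight q p.1 p.2 s) p

/-- The probability, given the hidden state `s` and the action `a`, that the observable part of the
following `m` steps is `g`. -/
noncomputable def bwd (M : POMDP U Z A ρ) (q : ℕ → U → A → ℝ≥0∞) (k : ℕ) {m : ℕ}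
    (g : Fin m → Z × A) (s : U) (a : A) : ℝ≥0∞ :=
  ∑' w : Fin m → Step U Z A ρ, {w | obsTail w = g}.indicator (M.tailWeight q k s a) w

theorem tsum_fwd_past (M : POMDP U Z A ρ) {q : ℕ → U → A → ℝ≥0∞} (hq : IsNormalized q) (k : ℕ) :
    ∑' s, ∑' h, M.fwd q {p : Z × (Fin k → Step U Z A ρ) | pastOf p = h} s = 1 := by
  rw [← M.tsum_prefixWeight hq k]
  refine tsum_congr fun s => ?_
  unfold fwd
  rw [ENNReal.tsum_comm, ENNReal.tsum_prod']
  refine tsum_congr fun z => tsum_congr fun y => ?_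
  rw [tsum_eq_single (pastOf (z, y))]
  · simp
  · intro h hh
    simp [hh.symm]

theorem tsum_bwd (M : POMDP U Z A ρ) {q : ℕ → U → A → ℝ≥0∞} (hq : IsNormalized q) (k m : ℕ)
    (s : U) (a : A) : ∑' g : Fin m → Z × A, M.bwd q k g s a = 1 := by
  rw [← M.tsum_tailWeight hq k m s a]
  unfold bwd
  rw [ENNReal.tsum_comm]
  refine tsum_congr fun w => ?_
  rw [tsum_eq_single (obsTail w)]
  · simp
  · intro h hh
    simp [hh.symm]

/-- Together with `bwd_congr` this is the locality of interventions: changing an action law leaves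
the weights of all steps strictly before it and strictly after it untouched. -/
theorem fwd_congr (M : POMDP U Z A ρ) {q q' : ℕ → U → A → ℝ≥0∞} {k : ℕ}
    (h : ∀ n < k, q n = q' n) (H : Set (Z × (Fin k → Step U Z A ρ))) (s : U) :
    M.fwd q H s = M.fwd q' H s := by
  unfold fwd prefixWeight stepWeight
  refine tsum_congr fun p => congrArg (fun f => H.indicator f p) (funext fun p => ?_)
  rw [Finset.prod_congr rfl fun (j : Fin k) _ => by rw [h j j.2]]

theorem bwd_congr (M : POMDP U Z A ρ) {q q' : ℕ → U → A → ℝ≥0∞} {k : ℕ}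
    (h : ∀ n, k ≤ n → q n = q' n) {m : ℕ} (g : Fin m → Z × A) (s : U) (a : A) :
    M.bwd q k g s a = M.bwd q' k g s a := by
  unfold bwd tailWeight stepWeight
  refine tsum_congr fun p => congrArg (fun f => Set.indicator _ f p) (funext fun p => ?_)
  rw [Finset.prod_congr rfl fun (j : Fin m) _ => by rw [h (k + j) (by omega)]]

/-- The mass of an event that is determined by the initial part of the trajectory, the step at
time `i` and the observable future. -/
theorem tsum_indicator_split (M : POMDP U Z A ρ) (q : ℕ → U → A → ℝ≥0∞) (i : Fin (N + 1))
    (H : Set (Z × (Fin i → Step U Z A ρ))) (f : Fut Z A (N - i)) (a : A) (s : U) (R : Set ρ) :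
    ∑' τ, {τ : Traj U Z A ρ N | (τ.zpre, (splitSeq _ i ((stepsEquiv U Z A ρ N).symm τ).2).1) ∈ H ∧
      τ.fut i = f ∧ τ.act i = a ∧ τ.st i = s ∧ τ.rew i ∈ R}.indicator (M.pathWeight q) τ =
    M.fwd q H s * (M.emit s f.1 * q i s a * ∑' r, R.indicator (M.reward s a) r) *
      M.bwd q (i + 1) f.2 s a := by
  classical
  rw [← (stepsEquiv U Z A ρ N).tsum_eq, ENNReal.tsum_prod']
  simp only [Set.indicator_apply, Set.mem_ofPred_eq, M.pathWeight_split q i, fut_stepsEquiv,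
    Equiv.symm_apply_apply]
  have h : ∀ z : Z, ∑' x : Fin (N + 1) → Step U Z A ρ,
      (if (z, (splitSeq _ i x).1) ∈ H ∧
        ((splitSeq _ i x).2.1.2.1, obsTail (splitSeq _ i x).2.2) = f ∧
        (splitSeq _ i x).2.1.2.2.1 = a ∧ (splitSeq _ i x).2.1.1 = s ∧
        (splitSeq _ i x).2.1.2.2.2 ∈ R then
        M.prefixWeight q z (splitSeq _ i x).1 (splitSeq _ i x).2.1.1 *
          M.stepWeight q i (splitSeq _ i x).2.1 *
          M.tailWeight q (i + 1) (splitSeq _ i x).2.1.1 (splitSeq _ i x).2.1.2.2.1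
          (splitSeq _ i x).2.2 else 0) =
      ∑' y : Fin i → Step U Z A ρ, (if (z, y) ∈ H then M.prefixWeight q z y s else 0) *
        ((M.emit s f.1 * q i s a * ∑' r, R.indicator (M.reward s a) r) *
          M.bwd q (i + 1) f.2 s a) := by
    intro z
    rw [← (splitSeq _ i).symm.tsum_eq, ENNReal.tsum_prod']
    refine tsum_congr fun y => ?_
    simp only [Equiv.apply_symm_apply]
    rw [ENNReal.tsum_prod', tsum_step, tsum_eq_single s, tsum_eq_single f.1, tsum_eq_single a,
      ← ENNReal.tsum_mul_left, ← ENNReal.tsum_mul_right, ← ENNReal.tsum_mul_left]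
    · refine tsum_congr fun r => ?_
      unfold bwd
      rw [← ENNReal.tsum_mul_left, ← ENNReal.tsum_mul_left]
      refine tsum_congr fun w => ?_
      by_cases h1 : (z, y) ∈ H
      · by_cases h2 : r ∈ R
        · by_cases h3 : obsTail w = f.2
          · simp [h1, h2, h3, stepWeight]; ring
          · simp [h1, h2, h3, Prod.ext_iff]
        · simp [h2]
      · simp [h1]
    · intro a' ha'; simp [ha']
    · intro a' ha'; simp [Prod.ext_iff, ha']
    · intro a' ha'; simp [ha']
  refine (tsum_congr h).trans ?_
  simp only [ENNReal.tsum_mul_right]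
  unfold fwd
  rw [ENNReal.tsum_prod']
  simp only [Set.indicator_apply]
  ring

/-- One step of forward filtering: the reward sums to one, and the hidden state of the step, being
unobserved, is summed over. -/
theorem fwd_snoc (M : POMDP U Z A ρ) (q : ℕ → U → A → ℝ≥0∞) {k : ℕ}
    (H : Set (Z × (Fin k → Step U Z A ρ))) (z : Z) (a : A) (s' : U) :
    M.fwd q {p : Z × (Fin (k + 1) → Step U Z A ρ) | (p.1, Fin.init p.2) ∈ H ∧
      (p.2 (Fin.last k)).2.1 = z ∧ (p.2 (Fin.last k)).2.2.1 = a} s' =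
    ∑' s, M.fwd q H s * M.emit s z * q k s a * M.trans s a s' := by
  classical
  unfold fwd
  rw [ENNReal.tsum_prod']
  simp only [tsum_snoc, Set.indicator_apply, Set.mem_ofPred_eq, Fin.init_snoc, Fin.snoc_last,
    prefixWeight_snoc, tsum_step]
  calc ∑' (z₀ : Z) (s : U) (z' : Z) (a' : A) (r : ρ) (y : Fin k → Step U Z A ρ),
      (if (z₀, y) ∈ H ∧ z' = z ∧ a' = a then
        M.prefixWeight q z₀ y s * M.stepWeight q k (s, z', a', r) * M.trans s a' s' else 0)
      = ∑' (z₀ : Z) (s : U) (r : ρ) (y : Fin k → Step U Z A ρ),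
        (if (z₀, y) ∈ H then M.prefixWeight q z₀ y s else 0) * (M.reward s a r *
          (M.emit s z * q k s a * M.trans s a s')) := by
        refine tsum_congr fun z₀ => tsum_congr fun s => ?_
        rw [tsum_eq_single z, tsum_eq_single a]
        · refine tsum_congr fun r => tsum_congr fun y => ?_
          by_cases h : (z₀, y) ∈ H
          · simp [h, stepWeight]; ring
          · simp [h]
        · intro a' ha'; simp [ha']
        · intro a' ha'; simp [ha']
    _ = _ := by
        simp only [ENNReal.tsum_mul_right, ENNReal.tsum_mul_left, PMF.tsum_coe, one_mul]
        rw [ENNReal.tsum_comm]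
        refine tsum_congr fun s => ?_
        rw [ENNReal.tsum_prod', ENNReal.tsum_mul_right]
        ring

end POMDP

/-! ### Laws under hidden policies -/

namespace POMDP

open scoped ENNReal

variable {U : Type u} {Z : Type v} {A : Type w} {ρ : Type x} {N : ℕ}

/-- The probability that the proxy history at time `k` is `h` and the hidden state is `s`. -/
noncomputable def pastLaw (M : POMDP U Z A ρ) (π : HiddenPolicy U A) {k : ℕ}
    (h : Hist Z A (k - 1)) (s : U) : ℝ :=
  (M.fwd (actionWeight π) {p : Z × (Fin k → Step U Z A ρ) | pastOf p = h} s).toReal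

/-- The probability of the observable future `f` at time `k`, given the hidden state and action. -/
noncomputable def futLaw (M : POMDP U Z A ρ) (π : HiddenPolicy U A) (k : ℕ) (a : A) {m : ℕ}
    (f : Fut Z A m) (s : U) : ℝ :=
  (M.emit s f.1 * M.bwd (actionWeight π) (k + 1) f.2 s a).toReal

theorem sum_pmf_toReal {α : Type*} [Fintype α] (p : PMF α) : ∑ a, (p a).toReal = 1 := by
  rw [← ENNReal.toReal_sum fun a _ => p.apply_ne_top a, ← tsum_fintype (L := .unconditional _),
    p.tsum_coe, ENNReal.toReal_one]

theorem bwd_ne_top (M : POMDP U Z A ρ) (π : HiddenPolicy U A) (k : ℕ) {m : ℕ}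
    (g : Fin m → Z × A) (s : U) (a : A) : M.bwd (actionWeight π) k g s a ≠ ∞ :=
  ne_top_of_le_ne_top ENNReal.one_ne_top
    ((ENNReal.le_tsum g).trans_eq (M.tsum_bwd (isNormalized_actionWeight π) k m s a))

theorem fwd_ne_top (M : POMDP U Z A ρ) (π : HiddenPolicy U A) {k : ℕ} (h : Hist Z A (k - 1))
    (s : U) : M.fwd (actionWeight π) {p : Z × (Fin k → Step U Z A ρ) | pastOf p = h} s ≠ ∞ :=
  ne_top_of_le_ne_top ENNReal.one_ne_top
    (((ENNReal.le_tsum h).trans (ENNReal.le_tsum (f := fun s => ∑' h, M.fwd (actionWeight π)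
      {p : Z × (Fin k → Step U Z A ρ) | pastOf p = h} s) s)).trans_eq
      (M.tsum_fwd_past (isNormalized_actionWeight π) k))

theorem sum_futLaw_tail [Fintype Z] [Fintype A] (M : POMDP U Z A ρ) (π : HiddenPolicy U A)
    (k : ℕ) (a : A) (m : ℕ) (z : Z) (s : U) :
    ∑ g : Fin m → Z × A, M.futLaw π k a (z, g) s = (M.emit s z).toReal := by
  unfold futLaw
  simp only [ENNReal.toReal_mul]
  rw [← Finset.mul_sum, ← ENNReal.toReal_sum fun g _ => M.bwd_ne_top π _ _ _ _,
    ← tsum_fintype (L := .unconditional _), M.tsum_bwd (isNormalized_actionWeight π)]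
  simp

theorem sum_futLaw [Fintype Z] [Fintype A] (M : POMDP U Z A ρ) (π : HiddenPolicy U A)
    (k : ℕ) (a : A) (m : ℕ) (s : U) : ∑ f : Fut Z A m, M.futLaw π k a f s = 1 := by
  rw [Fintype.sum_prod_type]
  simp only [sum_futLaw_tail, sum_pmf_toReal]

theorem pastLaw_congr (M : POMDP U Z A ρ) {π π' : HiddenPolicy U A} {k : ℕ}
    (hπ : ∀ n < k, π n = π' n) (h : Hist Z A (k - 1)) (s : U) :
    M.pastLaw π h s = M.pastLaw π' h s := by
  unfold pastLaw
  rw [M.fwd_congr (q' := actionWeight π') fun n hn => by unfold actionWeight; rw [hπ n hn]]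

/-- The action at time `k` is an argument here, not a random choice, so agreement strictly after `k`
suffices. -/
theorem futLaw_congr (M : POMDP U Z A ρ) {π π' : HiddenPolicy U A} {k : ℕ}
    (hπ : ∀ n, k < n → π n = π' n) (a : A) {m : ℕ} (f : Fut Z A m) (s : U) :
    M.futLaw π k a f s = M.futLaw π' k a f s := by
  unfold futLaw
  rw [M.bwd_congr (q' := actionWeight π') fun n hn => by
    unfold actionWeight; rw [hπ n (by omega)]]

/-- The hidden policy that chooses `a` at time `j` and otherwise follows `π`. -/
noncomputable def _root_.HiddenPolicy.doAt (π : HiddenPolicy U A) (j : ℕ) (a : A) :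
    HiddenPolicy U A :=
  fun n s => if n = j then PMF.pure a else π n s

/-- An intervened behavior policy is again a hidden policy, so the formulas for `P^b` also compute
the interventional laws. -/
theorem intervene_toPolicy (π : HiddenPolicy U A) (j : ℕ) (a : A) :
    (π.toPolicy Z).intervene j a = (π.doAt j a).toPolicy Z := by
  funext n s h
  simp only [Policy.intervene, HiddenPolicy.toPolicy, HiddenPolicy.doAt]

theorem tsum_indicator_fiber {T κ : Type*} [Fintype κ] (g : T → κ) (E : Set T) (f : T → ℝ≥0∞) :
    ∑' τ, E.indicator f τ = ∑ c, ∑' τ, {τ | τ ∈ E ∧ g τ = c}.indicator f τ := by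
  classical
  rw [← tsum_fintype (L := .unconditional _), ENNReal.tsum_comm]
  refine tsum_congr fun τ => ?_
  rw [tsum_eq_single (g τ)]
  · simp [Set.indicator_apply]
  · intro c hc
    simp [hc.symm]

theorem tsum_reward_ne_top (M : POMDP U Z A ρ) (s : U) (a : A) (R : Set ρ) :
    ∑' r, R.indicator (M.reward s a) r ≠ ∞ :=
  ne_top_of_le_ne_top ENNReal.one_ne_top
    ((ENNReal.tsum_le_tsum fun r => Set.indicator_le_self R _ r).trans_eq (PMF.tsum_coe _))

theorem stepMass_ne_top (M : POMDP U Z A ρ) (π : HiddenPolicy U A) (k : ℕ) {m : ℕ}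
    {c : ℝ≥0∞} (hc : c ≠ ∞) (f : Fut Z A m) (a : A) (s : U) (R : Set ρ) :
    c * (M.emit s f.1 * actionWeight π k s a * ∑' r, R.indicator (M.reward s a) r) *
      M.bwd (actionWeight π) (k + 1) f.2 s a ≠ ∞ :=
  ENNReal.mul_ne_top (ENNReal.mul_ne_top hc (ENNReal.mul_ne_top
    (ENNReal.mul_ne_top (PMF.apply_ne_top _ _) (PMF.apply_ne_top (π k s) a))
    (M.tsum_reward_ne_top s a R))) (M.bwd_ne_top π _ _ _ _)

open Classical in
/-- The law of the proxy history, future, action, hidden state and reward at a time `i`. -/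
theorem prob_hidden [Fintype U] [Fintype Z] [Fintype A] (M : POMDP U Z A ρ) (π : HiddenPolicy U A)
    (i : Fin (N + 1)) (K : Hist Z A (i - 1) → Fut Z A (N - i) → A → U → Prop) (R : Set ρ) :
    M.prob (N := N) (π.toPolicy Z)
      {τ | K (τ.past i) (τ.fut i) (τ.act i) (τ.st i) ∧ τ.rew i ∈ R} =
    ∑ s, ∑ a, ∑ h, ∑ f, if K h f a s then M.pastLaw (k := i) π h s * (π i s a).toReal *
      (∑' r, R.indicator (M.reward s a) r).toReal * M.futLaw π i a f s else 0 := by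
  have key : ∀ s a h f, ∑' τ, {τ : Traj U Z A ρ N |
      τ ∈ {τ : Traj U Z A ρ N | K (τ.past i) (τ.fut i) (τ.act i) (τ.st i) ∧ τ.rew i ∈ R} ∧
      (τ.st i, τ.act i, τ.past i, τ.fut i) = (s, a, h, f)}.indicator (M.weight (π.toPolicy Z)) τ =
      if K h f a s then M.fwd (actionWeight π)
        {p : Z × (Fin i → Step U Z A ρ) | pastOf p = h} s *
        (M.emit s f.1 * actionWeight π i s a * ∑' r, R.indicator (M.reward s a) r) *
        M.bwd (actionWeight π) (i + 1) f.2 s a else 0 := by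
    intro s a h f
    split_ifs with hK
    · rw [← M.tsum_indicator_split]
      refine tsum_congr fun τ => ?_
      obtain ⟨⟨z, x⟩, rfl⟩ := (stepsEquiv U Z A ρ N).surjective τ
      have hw : M.weight (π.toPolicy Z) = M.pathWeight (N := N) (actionWeight π) :=
        funext fun τ => M.weight_hidden π τ
      rw [hw]
      refine congrArg (fun E => Set.indicator E _ _) (Set.ext fun τ => ?_)
      obtain ⟨⟨z, x⟩, rfl⟩ := (stepsEquiv U Z A ρ N).surjective τ
      simp only [Set.mem_ofPred_eq, Prod.mk.injEq, past_stepsEquiv, Equiv.symm_apply_apply]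
      constructor
      · rintro ⟨⟨-, h1⟩, h2, h3, h4, h5⟩
        exact ⟨h4, h5, h3, h2, h1⟩
      · rintro ⟨h4, h5, h3, h2, h1⟩
        refine ⟨⟨?_, h1⟩, h2, h3, h4, h5⟩
        change pastOf (z, (splitSeq _ i x).1) = h at h4
        rw [h4, h5, h3, h2]
        exact hK
    · rw [ENNReal.tsum_eq_zero]
      intro τ
      apply Set.indicator_of_notMem
      rintro ⟨⟨h1, -⟩, h2⟩
      simp only [Prod.mk.injEq] at h2
      obtain ⟨rfl, rfl, rfl, rfl⟩ := h2
      exact hK h1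
  have hfin : ∀ s a h f, (if K h f a s then M.fwd (actionWeight π)
        {p : Z × (Fin i → Step U Z A ρ) | pastOf p = h} s *
        (M.emit s f.1 * actionWeight π i s a * ∑' r, R.indicator (M.reward s a) r) *
        M.bwd (actionWeight π) (i + 1) f.2 s a else 0) ≠ ∞ := by
    intro s a h f
    split_ifs
    · exact M.stepMass_ne_top π i (M.fwd_ne_top π h s) f a s R
    · exact ENNReal.zero_ne_top
  unfold prob
  rw [tsum_indicator_fiber (fun τ : Traj U Z A ρ N => (τ.st i, τ.act i, τ.past i, τ.fut i)),
    ENNReal.toReal_sum]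
  · simp only [Fintype.sum_prod_type (α₁ := U), Fintype.sum_prod_type (α₁ := A),
      Fintype.sum_prod_type (α₁ := Hist Z A (i - 1)), key]
    refine Finset.sum_congr rfl fun s _ => Finset.sum_congr rfl fun a _ =>
      Finset.sum_congr rfl fun h _ => Finset.sum_congr rfl fun f _ => ?_
    split_ifs
    · simp only [pastLaw, futLaw, actionWeight, ENNReal.toReal_mul]
      ring
    · rfl
  · rintro ⟨s, a, h, f⟩ -
    rw [key]
    exact hfin s a h f

/-- The law of the data at two consecutive times. -/
theorem prob_succ [Fintype U] [Fintype Z] [Fintype A] (M : POMDP U Z A ρ) (π : HiddenPolicy U A)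
    (i : Fin N) (f : Fut Z A (N - i.succ)) (a' a : A) (z : Z)
    (h : Hist Z A (i.castSucc - 1)) :
    M.prob (N := N) (π.toPolicy Z) {τ | τ.fut i.succ = f ∧ τ.act i.succ = a' ∧
      τ.ob i.castSucc = z ∧ τ.act i.castSucc = a ∧ τ.past i.castSucc = h} =
    ∑ s', (∑ s, M.pastLaw (k := i.castSucc) π h s * (M.emit s z).toReal *
        (π i.castSucc s a).toReal * (M.trans s a s').toReal) *
      (π i.succ s' a').toReal * M.futLaw π i.succ a' f s' := by
  have key : ∀ s', ∑' τ, {τ : Traj U Z A ρ N |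
      τ ∈ {τ : Traj U Z A ρ N | τ.fut i.succ = f ∧ τ.act i.succ = a' ∧
      τ.ob i.castSucc = z ∧ τ.act i.castSucc = a ∧ τ.past i.castSucc = h} ∧
      τ.st i.succ = s'}.indicator (M.weight (π.toPolicy Z)) τ =
      (∑' s, M.fwd (actionWeight π)
        {p : Z × (Fin i → Step U Z A ρ) | pastOf p = h} s * M.emit s z *
          actionWeight π i s a * M.trans s a s') *
        (M.emit s' f.1 * actionWeight π i.succ s' a' *
          ∑' r, Set.univ.indicator (M.reward s' a') r) *
        M.bwd (actionWeight π) (i.succ + 1) f.2 s' a' := by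
    intro s'
    have hw : M.weight (π.toPolicy Z) = M.pathWeight (N := N) (actionWeight π) :=
      funext fun τ => M.weight_hidden π τ
    rw [← M.fwd_snoc, ← M.tsum_indicator_split (i := i.succ), hw]
    refine tsum_congr fun τ => congrArg (fun E => Set.indicator E _ _) (Set.ext fun τ => ?_)
    obtain ⟨⟨z, x⟩, rfl⟩ := (stepsEquiv U Z A ρ N).surjective τ
    simp only [Set.mem_ofPred_eq, past_stepsEquiv, Equiv.symm_apply_apply, Set.mem_univ, and_true]
    constructor
    · rintro ⟨⟨h1, h2, h3, h4, h5⟩, h6⟩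
      exact ⟨⟨h5, h3, h4⟩, h1, h2, h6⟩
    · rintro ⟨⟨h5, h3, h4⟩, h1, h2, h6⟩
      exact ⟨⟨h1, h2, h3, h4, h5⟩, h6⟩
  have hfin : ∀ s s', M.fwd (actionWeight π)
        {p : Z × (Fin i → Step U Z A ρ) | pastOf p = h} s * M.emit s z *
          actionWeight π i s a * M.trans s a s' ≠ ∞ := fun s s' =>
    ENNReal.mul_ne_top (ENNReal.mul_ne_top (ENNReal.mul_ne_top (M.fwd_ne_top π h s)
      (PMF.apply_ne_top _ _)) (PMF.apply_ne_top (π i s) a)) (PMF.apply_ne_top _ _)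
  unfold prob
  rw [tsum_indicator_fiber (fun τ : Traj U Z A ρ N => τ.st i.succ), ENNReal.toReal_sum]
  · refine Finset.sum_congr rfl fun s' _ => ?_
    rw [key]
    simp only [tsum_fintype, Set.indicator_univ, PMF.tsum_coe, mul_one, ENNReal.toReal_mul,
      futLaw, pastLaw]
    rw [ENNReal.toReal_sum fun s _ => hfin s s']
    simp only [ENNReal.toReal_mul, Fin.val_castSucc, actionWeight]
    ring
  · rintro s' -
    rw [key]
    refine M.stepMass_ne_top π i.succ ?_ f a' s' Set.univ
    rw [tsum_fintype]
    exact ENNReal.sum_ne_top.2 fun s _ => hfin s s'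

end POMDP

/-! ### The observable matrices -/

namespace POMDP

open scoped ENNReal

variable {U : Type u} {Z : Type v} {A : Type w} {ρ : Type x} {N : ℕ}

theorem tsum_reward_univ (M : POMDP U Z A ρ) (s : U) (a : A) :
    (∑' r, (Set.univ : Set ρ).indicator (M.reward s a) r).toReal = 1 := by
  simp

theorem tsum_reward_singleton (M : POMDP U Z A ρ) (s : U) (a : A) (r : ρ) :
    (∑' r', ({r} : Set ρ).indicator (M.reward s a) r').toReal = (M.reward s a r).toReal := by
  classical
  rw [tsum_eq_single r (fun b hb => by simp [hb])]
  simp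

theorem doAt_self (π : HiddenPolicy U A) (j : ℕ) (a : A) (s : U) :
    π.doAt j a j s = PMF.pure a := by simp [HiddenPolicy.doAt]

theorem doAt_of_ne (π : HiddenPolicy U A) {n j : ℕ} (a : A) (h : n ≠ j) :
    π.doAt j a n = π n := by
  funext s; simp [HiddenPolicy.doAt, h]

theorem tsum_weight_ne_top (M : POMDP U Z A ρ) (π : HiddenPolicy U A)
    (E : Set (Traj U Z A ρ N)) : ∑' τ, E.indicator (M.weight (π.toPolicy Z)) τ ≠ ∞ :=
  ne_top_of_le_ne_top ((M.tsum_pathWeight (isNormalized_actionWeight π)).trans_ne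
    ENNReal.one_ne_top) (ENNReal.tsum_le_tsum fun τ => Set.indicator_le_self _ _ τ)

theorem prob_fiber {κ : Type*} [Fintype κ] (M : POMDP U Z A ρ) (π : HiddenPolicy U A)
    (g : Traj U Z A ρ N → κ) (E : Set (Traj U Z A ρ N)) :
    M.prob (π.toPolicy Z) E = ∑ c, M.prob (π.toPolicy Z) {τ | τ ∈ E ∧ g τ = c} := by
  unfold prob
  rw [tsum_indicator_fiber g, ENNReal.toReal_sum fun c _ => M.tsum_weight_ne_top π _]

variable [Fintype Z] [Fintype A]

/-- The law of the initial hidden state, as the marginal of the law of the proxy history. -/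
noncomputable def startLaw (M : POMDP U Z A ρ) (π : HiddenPolicy U A) (s : U) : ℝ :=
  ∑ h, M.pastLaw (k := 0) π h s

/-- The marginal form of the initial law is the one that a relabelling of hidden states at time 0
transports; `M.init` is the one that enters the law of the reward. -/
theorem startLaw_eq (M : POMDP U Z A ρ) (π : HiddenPolicy U A) (s : U) :
    M.startLaw π s = (M.init s).toReal := by
  unfold startLaw pastLaw
  rw [← ENNReal.toReal_sum fun h _ => M.fwd_ne_top π h s, ← tsum_fintype (L := .unconditional _)]
  unfold fwd
  rw [ENNReal.tsum_comm, ENNReal.tsum_prod']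
  congr 1
  calc _ = ∑' (z : Z), M.init s * M.pre s z := by
        refine tsum_congr fun z => ?_
        rw [tsum_eq_single (fun i : Fin 0 => i.elim0) (fun y hy => absurd (Subsingleton.elim _ _) hy),
          tsum_eq_single (pastOf (z, (fun i : Fin 0 => i.elim0 : Fin 0 → Step U Z A ρ)))]
        · simp [prefixWeight, stateAt]
        · intro h hh
          simp [hh.symm]
    _ = M.init s := by rw [ENNReal.tsum_mul_left, PMF.tsum_coe, mul_one]

variable [Fintype U]

/-- Conditional independence given hidden state and action: over product events the sums over
histories, rewards and futures separate. -/
theorem prob_event (M : POMDP U Z A ρ) (π : HiddenPolicy U A) (i : Fin (N + 1))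
    (Hs : Set (Hist Z A (i - 1))) (Fs : Set (Fut Z A (N - i))) (a : A) (Us : Set U) (R : Set ρ) :
    M.prob (N := N) (π.toPolicy Z)
      {τ | (τ.past i ∈ Hs ∧ τ.fut i ∈ Fs ∧ τ.act i = a ∧ τ.st i ∈ Us) ∧ τ.rew i ∈ R} =
    ∑ s, Us.indicator (fun s => (∑ h, Hs.indicator (fun h => M.pastLaw (k := i) π h s) h) *
      (π i s a).toReal * (∑' r, R.indicator (M.reward s a) r).toReal *
      ∑ f, Fs.indicator (fun f => M.futLaw π i a f s) f) s := by
  classical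
  rw [M.prob_hidden π i (fun h f b s => h ∈ Hs ∧ f ∈ Fs ∧ b = a ∧ s ∈ Us) R]
  refine Finset.sum_congr rfl fun s _ => ?_
  rw [Finset.sum_eq_single a (fun b _ hb => by simp [hb]) (by simp)]
  by_cases hs : s ∈ Us
  · rw [Set.indicator_of_mem hs, Finset.sum_mul, Finset.sum_mul, Finset.sum_mul]
    refine Finset.sum_congr rfl fun h _ => ?_
    rw [Finset.mul_sum]
    refine Finset.sum_congr rfl fun f _ => ?_
    by_cases h1 : h ∈ Hs <;> by_cases h2 : f ∈ Fs <;> simp [h1, h2, hs]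
  · simp [hs]

theorem sum_indicator_singleton {α : Type*} [Fintype α] (a : α) (g : α → ℝ) :
    ∑ b, ({a} : Set α).indicator g b = g a := by
  classical
  simp [Set.indicator_apply]

theorem prob_act_past (M : POMDP U Z A ρ) (π : HiddenPolicy U A) (i : Fin (N + 1)) (a : A)
    (h : Hist Z A (i - 1)) :
    M.prob (N := N) (π.toPolicy Z) {τ | τ.act i = a ∧ τ.past i = h} =
      ∑ s, M.pastLaw (k := i) π h s * (π i s a).toReal := by
  have := M.prob_event (N := N) π i {h} Set.univ a Set.univ Set.univ
  simp only [Set.mem_univ, Set.mem_singleton_iff, and_true, true_and, Set.indicator_univ,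
    sum_futLaw, sum_indicator_singleton, PMF.tsum_coe, ENNReal.toReal_one, mul_one] at this
  rw [← this]
  exact congrArg _ (Set.ext fun τ => and_comm)

theorem prob_fut_act_past (M : POMDP U Z A ρ) (π : HiddenPolicy U A) (i : Fin (N + 1)) (a : A)
    (f : Fut Z A (N - i)) (h : Hist Z A (i - 1)) :
    M.prob (N := N) (π.toPolicy Z) ({τ | τ.fut i = f} ∩ {τ | τ.act i = a ∧ τ.past i = h}) =
      ∑ s, M.pastLaw (k := i) π h s * (π i s a).toReal * M.futLaw π i a f s := by
  have := M.prob_event (N := N) π i {h} {f} a Set.univ Set.univ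
  simp only [Set.mem_univ, Set.mem_singleton_iff, and_true, Set.indicator_univ,
    sum_indicator_singleton, PMF.tsum_coe, ENNReal.toReal_one, mul_one] at this
  rw [← this]
  exact congrArg _ (Set.ext fun τ => by
    simp only [Set.mem_inter_iff, Set.mem_ofPred_eq]; tauto)

theorem prob_fut_rew_act_past (M : POMDP U Z A ρ) (π : HiddenPolicy U A) (i : Fin (N + 1)) (a : A)
    (r : ρ) (f : Fut Z A (N - i)) (h : Hist Z A (i - 1)) :
    M.prob (N := N) (π.toPolicy Z)
      {τ | (τ.past i = h ∧ τ.fut i = f ∧ τ.act i = a) ∧ τ.rew i = r} =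
      ∑ s, M.pastLaw (k := i) π h s * (π i s a).toReal * (M.reward s a r).toReal *
        M.futLaw π i a f s := by
  have := M.prob_event (N := N) π i {h} {f} a Set.univ {r}
  simpa only [Set.mem_univ, Set.mem_singleton_iff, and_true, Set.indicator_univ,
    sum_indicator_singleton, tsum_reward_singleton] using this

theorem prob_rew_ob_act_past (M : POMDP U Z A ρ) (π : HiddenPolicy U A) (i : Fin (N + 1)) (a : A)
    (r : ρ) (z : Z) (h : Hist Z A (i - 1)) :
    M.prob (N := N) (π.toPolicy Z) ({τ | τ.rew i = r ∧ τ.ob i = z} ∩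
      {τ | τ.act i = a ∧ τ.past i = h}) =
      ∑ s, M.pastLaw (k := i) π h s * (π i s a).toReal * (M.reward s a r).toReal *
        (M.emit s z).toReal := by
  classical
  have := M.prob_event (N := N) π i {h} {f | f.1 = z} a Set.univ {r}
  have h2 : ∀ s, ∑ f, {f : Fut Z A (N - i) | f.1 = z}.indicator
      (fun f => M.futLaw π i a f s) f = (M.emit s z).toReal := by
    intro s
    rw [← M.sum_futLaw_tail π i a (N - i), Fintype.sum_prod_type, Finset.sum_eq_single z]
    · simp
    · intro z' _ hz
      simp [hz]
    · simp
  simp only [Set.mem_univ, Set.mem_singleton_iff, and_true, Set.indicator_univ,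
    sum_indicator_singleton, tsum_reward_singleton, h2] at this
  rw [← this]
  refine congrArg _ (Set.ext fun τ => ?_)
  simp only [Set.mem_inter_iff, Set.mem_ofPred_eq, Traj.fut]; tauto

theorem prob_act_state (M : POMDP U Z A ρ) (π : HiddenPolicy U A) (i : Fin (N + 1)) (a : A)
    (Fs : Set (Fut Z A (N - i))) (s : U) (R : Set ρ) :
    M.prob (N := N) (π.toPolicy Z) ({τ | τ.fut i ∈ Fs ∧ τ.rew i ∈ R} ∩
      {τ | τ.act i = a ∧ τ.st i = s}) =
      (∑ h, M.pastLaw (k := i) π h s) * (π i s a).toReal *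
        (∑' r, R.indicator (M.reward s a) r).toReal *
        ∑ f, Fs.indicator (fun f => M.futLaw π i a f s) f := by
  have := M.prob_event (N := N) π i Set.univ Fs a {s} R
  simp only [Set.mem_univ, true_and, Set.mem_singleton_iff, Set.indicator_univ,
    sum_indicator_singleton] at this
  rw [← this]
  exact congrArg _ (Set.ext fun τ => by
    simp only [Set.mem_inter_iff, Set.mem_ofPred_eq]; tauto)

/-- The past factor and the policy cancel. The hypothesis says that the conditioning event is not
null; otherwise the left side would be `0` by convention. -/
theorem rewProb_eq (M : POMDP U Z A ρ) (π : HiddenPolicy U A) (i : Fin (N + 1)) (a : A) (r : ρ)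
    (s : U) (hs : (∑ h, M.pastLaw (k := i) π h s) * (π i s a).toReal ≠ 0) :
    M.rewProb (N := N) π i r a s = (M.reward s a r).toReal := by
  have h1 := M.prob_act_state (N := N) π i a Set.univ s {r}
  have h2 := M.prob_act_state (N := N) π i a Set.univ s Set.univ
  simp only [Set.mem_univ, true_and, and_true, Set.mem_singleton_iff, Set.indicator_univ,
    tsum_reward_singleton, sum_futLaw, mul_one, PMF.tsum_coe, ENNReal.toReal_one,
    Set.ofPred_true, Set.univ_inter] at h1 h2
  unfold rewProb condProb
  rw [h1, h2, mul_div_cancel_left₀ _ hs]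

/-- The conditional law of the future given the hidden state and the action `a`. -/
noncomputable def futKernel (M : POMDP U Z A ρ) (π : HiddenPolicy U A) (i : Fin (N + 1)) (a : A) :
    Matrix (Fut Z A (N - i)) U ℝ :=
  Matrix.of fun f s => M.futLaw π i a f s

/-- The conditional law of the hidden state given the proxy history and the action `a`. -/
noncomputable def stateKernel (M : POMDP U Z A ρ) (π : HiddenPolicy U A) (i : Fin (N + 1)) (a : A) :
    Matrix U (Hist Z A (i - 1)) ℝ :=
  Matrix.of fun s h => M.pastLaw (k := i) π h s * (π i s a).toReal /
    M.prob (N := N) (π.toPolicy Z) {τ | τ.act i = a ∧ τ.past i = h}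

/-- Observing `z`, playing `a` and moving to the next hidden state. -/
noncomputable def obsTrans (M : POMDP U Z A ρ) (z : Z) (a : A) : Matrix U U ℝ :=
  Matrix.of fun s' s => (M.emit s z).toReal * (M.trans s a s').toReal

/-- No positivity is needed: for a null history both sides are quotients by the same zero, hence
`0`. The same holds for `rewRow_eq` and `doMatrix_eq`. -/
theorem futMatrix_eq (M : POMDP U Z A ρ) (π : HiddenPolicy U A) (i : Fin (N + 1)) (a : A) :
    M.futMatrix π i a = M.futKernel π i a * M.stateKernel π i a := by
  ext f h
  simp only [futMatrix, condProb, Matrix.of_apply, Matrix.mul_apply, prob_fut_act_past,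
    futKernel, stateKernel, Finset.sum_div]
  exact Finset.sum_congr rfl fun s _ => by ring

theorem rewRow_eq (M : POMDP U Z A ρ) (π : HiddenPolicy U A) (i : Fin (N + 1)) (r : ρ) (z : Z)
    (a : A) : M.rewRow π i r z a =
      (fun s => (M.emit s z).toReal * (M.reward s a r).toReal) ᵥ* M.stateKernel π i a := by
  ext h
  simp only [rewRow, condProb, Matrix.of_apply, Matrix.vecMul, dotProduct, prob_rew_ob_act_past,
    stateKernel, Finset.sum_div]
  exact Finset.sum_congr rfl fun s _ => by ring

/-- The intervention at time `i + 1` leaves the laws before and after it unchanged and replaces the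
behavior factor at that time by a point mass. This removes the policy factor between the future and
the transition. -/
theorem doMatrix_eq (M : POMDP U Z A ρ) (π : HiddenPolicy U A) (i : Fin N) (z : Z) (a a' : A) :
    M.doMatrix π i z a a' =
      M.futKernel π i.succ a' * M.obsTrans z a * M.stateKernel π i.castSucc a := by
  classical
  have hden : ∀ h : Hist Z A (i.castSucc - 1),
      M.prob (N := N) ((π.doAt i.succ a').toPolicy Z)
        {τ | τ.act i.castSucc = a ∧ τ.past i.castSucc = h} =
      M.prob (N := N) (π.toPolicy Z) {τ | τ.act i.castSucc = a ∧ τ.past i.castSucc = h} := by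
    intro h
    rw [prob_act_past, prob_act_past]
    refine Finset.sum_congr rfl fun s _ => ?_
    rw [M.pastLaw_congr (π' := π) fun n hn => doAt_of_ne π a' (by simp at hn ⊢; omega),
      doAt_of_ne π a' (by simp)]
  have hnum : ∀ (f : Fut Z A (N - i.succ)) (h : Hist Z A (i.castSucc - 1)),
      M.prob (N := N) ((π.doAt i.succ a').toPolicy Z)
        ({τ | τ.fut i.succ = f ∧ τ.ob i.castSucc = z} ∩
          {τ | τ.act i.castSucc = a ∧ τ.past i.castSucc = h}) =
      ∑ s', (∑ s, M.pastLaw (k := i.castSucc) π h s * (M.emit s z).toReal *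
        (π i.castSucc s a).toReal * (M.trans s a s').toReal) * M.futLaw π i.succ a' f s' := by
    intro f h
    -- The formula for two consecutive times fixes the later action; summing over its values, the
    -- point mass keeps only `a'`.
    rw [M.prob_fiber (π.doAt i.succ a') (fun τ => τ.act i.succ)]
    have h1 : ∀ b, M.prob (N := N) ((π.doAt i.succ a').toPolicy Z)
        {τ | τ ∈ ({τ : Traj U Z A ρ N | τ.fut i.succ = f ∧ τ.ob i.castSucc = z} ∩
          {τ | τ.act i.castSucc = a ∧ τ.past i.castSucc = h}) ∧ τ.act i.succ = b} =
        ∑ s', (∑ s, M.pastLaw (k := i.castSucc) π h s * (M.emit s z).toReal *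
          (π i.castSucc s a).toReal * (M.trans s a s').toReal) *
          ((PMF.pure a' : PMF A) b).toReal * M.futLaw π i.succ b f s' := by
      intro b
      rw [show {τ : Traj U Z A ρ N | τ ∈ ({τ : Traj U Z A ρ N | τ.fut i.succ = f ∧
          τ.ob i.castSucc = z} ∩ {τ | τ.act i.castSucc = a ∧ τ.past i.castSucc = h}) ∧
          τ.act i.succ = b} = {τ | τ.fut i.succ = f ∧ τ.act i.succ = b ∧
          τ.ob i.castSucc = z ∧ τ.act i.castSucc = a ∧ τ.past i.castSucc = h} from
        Set.ext fun τ => by simp only [Set.mem_inter_iff, Set.mem_ofPred_eq]; tauto,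
        prob_succ]
      refine Finset.sum_congr rfl fun s' _ => ?_
      rw [doAt_self, M.futLaw_congr (π' := π) fun n hn => doAt_of_ne π a' (by omega)]
      congr 2
      refine Finset.sum_congr rfl fun s _ => ?_
      rw [M.pastLaw_congr (π' := π) fun n hn => doAt_of_ne π a' (by simp at hn ⊢; omega),
        doAt_of_ne π a' (by simp)]
    rw [Finset.sum_congr rfl fun b _ => h1 b, Finset.sum_eq_single a']
    · simp
    · intro b _ hb
      simp [hb]
    · simp
  ext f h
  simp only [doMatrix, condProb, intervene_toPolicy, Matrix.of_apply, hnum, hden]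
  rw [Matrix.mul_assoc, Matrix.mul_apply, Finset.sum_div]
  refine Finset.sum_congr rfl fun s' _ => ?_
  simp only [futKernel, Matrix.of_apply, Matrix.mul_apply, obsTrans, stateKernel]
  rw [mul_comm, mul_div_assoc, Finset.sum_div]
  congr 1
  exact Finset.sum_congr rfl fun s _ => by ring

theorem doInit_eq (M : POMDP U Z A ρ) (π : HiddenPolicy U A) (a : A) :
    M.doInit π N a = M.futKernel (N := N) π 0 a *ᵥ M.startLaw π := by
  classical
  ext f
  unfold doInit
  rw [intervene_toPolicy, M.prob_fiber (π.doAt 0 a) (fun τ => τ.act 0)]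
  have h1 : ∀ b, M.prob (N := N) ((π.doAt 0 a).toPolicy Z)
        {τ | τ ∈ {τ : Traj U Z A ρ N | τ.fut 0 = f} ∧ τ.act 0 = b} =
        ∑ s, M.startLaw π s * ((PMF.pure a : PMF A) b).toReal * M.futLaw π 0 b f s := by
    intro b
    have := M.prob_event (N := N) (π.doAt 0 a) 0 Set.univ {f} b Set.univ Set.univ
    simp only [Set.mem_univ, Set.mem_singleton_iff, true_and, and_true, Set.indicator_univ,
      sum_indicator_singleton, PMF.tsum_coe, ENNReal.toReal_one, mul_one] at this
    refine Eq.trans this (Finset.sum_congr rfl fun s _ => ?_)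
    have h0 : ((0 : Fin (N + 1)) : ℕ) = 0 := rfl
    rw [M.futLaw_congr (π' := π) fun n hn => doAt_of_ne π a (by omega)]
    simp only [h0, doAt_self]
    rfl
  rw [Finset.sum_congr rfl fun b _ => h1 b, Finset.sum_eq_single a]
  · simp only [PMF.pure_apply, if_true, ENNReal.toReal_one, mul_one, Matrix.mulVec, dotProduct,
      futKernel, Matrix.of_apply]
    exact Finset.sum_congr rfl fun s _ => mul_comm _ _
  · intro b _ hb
    simp [hb]
  · simp

end POMDP

/-! ### Observable policies -/

namespace POMDP

open scoped ENNReal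

variable {U : Type u} {Z : Type v} {A : Type w} {ρ : Type x} {N : ℕ}

/-- Lengthening the horizon multiplies the weight by conditional laws only. The new history `η`
depends on the step `s` only through its observation, so these factors can be summed out one after
another. -/
theorem exists_weight_snoc (M : POMDP U Z A ρ) (π : Policy U Z A) (z : Z)
    (y : Fin (N + 1) → Step U Z A ρ) :
    ∃ (η : Z → Hist Z A (N + 1)) (p : U × A), ∀ s : Step U Z A ρ,
      M.weight π (stepsEquiv U Z A ρ (N + 1)
        (z, (Fin.snoc (α := fun _ => Step U Z A ρ) y s : Fin (N + 2) → _))) =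
      M.weight π (stepsEquiv U Z A ρ N (z, y)) *
        (M.trans p.1 p.2 s.1 * (M.emit s.1 s.2.1 * (π (N + 1) s.1 (η s.2.1) s.2.2.1 *
          M.reward s.1 s.2.2.1 s.2.2.2))) := by
  refine ⟨fun z' => (Fin.snoc (α := fun _ => Z) (fun k => (y k).2.1) z', fun k => (y k).2.2.1),
    ((y (Fin.last N)).1, (y (Fin.last N)).2.2.1), fun s => ?_⟩
  have h1 : ∀ j : Fin (N + 1), prefixHist
      (stepsEquiv U Z A ρ (N + 1)
        (z, (Fin.snoc (α := fun _ => Step U Z A ρ) y s : Fin (N + 2) → _))).ob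
      (stepsEquiv U Z A ρ (N + 1)
        (z, (Fin.snoc (α := fun _ => Step U Z A ρ) y s : Fin (N + 2) → _))).act j.castSucc =
      prefixHist (stepsEquiv U Z A ρ N (z, y)).ob (stepsEquiv U Z A ρ N (z, y)).act j := by
    intro j
    refine Prod.ext (funext fun k => ?_) (funext fun k => ?_)
    · have : (k : ℕ) ≤ N := by have := k.2; simp at this; omega
      simp [prefixHist, stepsEquiv, Fin.snoc, this]
    · have : (k : ℕ) ≤ N := by have := k.2; simp at this; omega
      simp [prefixHist, stepsEquiv, Fin.snoc, this]
  have h2 : prefixHist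
      (stepsEquiv U Z A ρ (N + 1)
        (z, (Fin.snoc (α := fun _ => Step U Z A ρ) y s : Fin (N + 2) → _))).ob
      (stepsEquiv U Z A ρ (N + 1)
        (z, (Fin.snoc (α := fun _ => Step U Z A ρ) y s : Fin (N + 2) → _))).act (Fin.last (N + 1)) =
      ((Fin.snoc (α := fun _ => Z) (fun k => (y k).2.1) s.2.1, fun k => (y k).2.2.1) :
        Hist Z A (N + 1)) := by
    refine Prod.ext (funext fun k => ?_) (funext fun k => ?_)
    · by_cases hk : (k : ℕ) ≤ N
      · simp [prefixHist, stepsEquiv, Fin.snoc, hk]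
      · simp [prefixHist, stepsEquiv, Fin.snoc, hk]
    · have : (k : ℕ) ≤ N := by have := k.2; simp at this; omega
      simp [prefixHist, stepsEquiv, Fin.snoc, this]
  have h0 : (0 : Fin (N + 2)) = Fin.castSucc 0 := rfl
  unfold weight
  rw [Fin.prod_univ_castSucc (n := N + 1), h2, Fin.prod_univ_castSucc (n := N) fun i => M.trans
    ((stepsEquiv U Z A ρ (N + 1)
        (z, (Fin.snoc (α := fun _ => Step U Z A ρ) y s : Fin (N + 2) → _))).st i.castSucc) _ _]
  simp only [h1]
  simp only [stepsEquiv, Equiv.coe_fn_mk, h0, Fin.snoc_castSucc, Fin.snoc_last, Fin.succ_castSucc,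
    Fin.succ_last, Fin.val_castSucc, Fin.val_last]
  ring

/-- The extra step comes after time `t` and its factors sum to one, for every policy. -/
theorem prob_rew_succ (M : POMDP U Z A ρ) (π : Policy U Z A) (t : Fin (N + 1)) (r : ρ) :
    M.prob (N := N + 1) π {τ | τ.rew t.castSucc = r} = M.prob (N := N) π {τ | τ.rew t = r} := by
  classical
  unfold prob
  congr 1
  rw [← (stepsEquiv U Z A ρ N).tsum_eq, ← (stepsEquiv U Z A ρ (N + 1)).tsum_eq,
    ENNReal.tsum_prod', ENNReal.tsum_prod']
  refine tsum_congr fun z => ?_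
  rw [tsum_snoc, ENNReal.tsum_comm]
  refine tsum_congr fun y => ?_
  obtain ⟨η, p, h⟩ := M.exists_weight_snoc π z y
  simp only [Set.indicator_apply, Set.mem_ofPred_eq, h]
  simp only [stepsEquiv, Equiv.coe_fn_mk, Fin.snoc_castSucc]
  by_cases hr : (y t).2.2.2 = r
  · simp only [hr, if_true]
    rw [ENNReal.tsum_mul_left, tsum_step]
    simp only [ENNReal.tsum_mul_left, PMF.tsum_coe, mul_one]
  · simp [hr]

theorem prob_rew_truncate (M : POMDP U Z A ρ) (π : Policy U Z A) (t : ℕ) (r : ρ) (d : ℕ) :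
    M.prob (N := t + d) π {τ | τ.rew ⟨t, by omega⟩ = r} =
      M.prob (N := t) π {τ | τ.rew (Fin.last t) = r} := by
  induction d with
  | zero => rfl
  | succ d ih => rw [← ih]; exact M.prob_rew_succ (N := t + d) π ⟨t, by omega⟩ r

theorem pathWeight_snoc (M : POMDP U Z A ρ) (q : ℕ → U → A → ℝ≥0∞) {t : ℕ} (z : Z)
    (y : Fin t → Step U Z A ρ) (s : Step U Z A ρ) :
    M.pathWeight q (stepsEquiv U Z A ρ t
      (z, (Fin.snoc (α := fun _ => Step U Z A ρ) y s : Fin (t + 1) → _))) =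
      M.prefixWeight q z y s.1 * M.stepWeight q t s := by
  have : IsEmpty (Fin (t - (Fin.last t : Fin (t + 1)))) := by simp; infer_instance
  have h1 : (splitSeq _ (Fin.last t)
      (Fin.snoc (α := fun _ => Step U Z A ρ) y s : Fin (t + 1) → _)).1 = y := by
    funext k
    exact Fin.snoc_castSucc (α := fun _ => Step U Z A ρ) s y k
  have h2 : (splitSeq _ (Fin.last t)
      (Fin.snoc (α := fun _ => Step U Z A ρ) y s : Fin (t + 1) → _)).2.1 = s :=
    Fin.snoc_last (α := fun _ => Step U Z A ρ) s y
  rw [M.pathWeight_split q (Fin.last t), h1, h2]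
  unfold tailWeight
  rw [Finset.prod_of_isEmpty, mul_one]
  rfl

variable [Fintype U]

/-- The policy-free weight of observing `zs` and arriving at `s` when the actions are `as`. -/
noncomputable def obsForward (M : POMDP U Z A ρ) : (k : ℕ) → (Fin k → Z) → (Fin k → A) → U → ℝ≥0∞
  | 0, _, _, s => M.init s
  | k + 1, zs, as, s' => ∑ s, M.obsForward k (Fin.init zs) (Fin.init as) s *
      (M.emit s (zs (Fin.last k)) * M.trans s (as (Fin.last k)) s')

theorem obsForward_ne_top (M : POMDP U Z A ρ) (k : ℕ) (zs : Fin k → Z) (as : Fin k → A) (s : U) :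
    M.obsForward k zs as s ≠ ∞ := by
  induction k generalizing s with
  | zero => exact PMF.apply_ne_top _ _
  | succ k ih =>
    exact ENNReal.sum_ne_top.2 fun s' _ => ENNReal.mul_ne_top (ih _ _ _)
      (ENNReal.mul_ne_top (PMF.apply_ne_top _ _) (PMF.apply_ne_top _ _))

open Classical in
theorem obsForward_toReal (M : POMDP U Z A ρ) (k : ℕ) (zs : Fin k → Z) (as : Fin k → A) :
    (fun s => (M.obsForward k zs as s).toReal) =
      (List.ofFn fun i => M.obsTrans (zs i) (as i)).reverse.prod *ᵥ
        fun s => (M.init s).toReal := by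
  induction k with
  | zero => simp [obsForward]
  | succ k ih =>
    rw [List.ofFn_succ', List.concat_eq_append, List.reverse_append]
    simp only [List.reverse_singleton, List.singleton_append, List.prod_cons]
    rw [← Matrix.mulVec_mulVec]
    have := ih (Fin.init zs) (Fin.init as)
    simp only [Fin.init] at this
    rw [← this]
    funext s
    rw [obsForward, ENNReal.toReal_sum fun s' _ => ENNReal.mul_ne_top (M.obsForward_ne_top _ _ _ _)
      (ENNReal.mul_ne_top (PMF.apply_ne_top _ _) (PMF.apply_ne_top _ _))]
    simp only [Matrix.mulVec, dotProduct, obsTrans, Matrix.of_apply, ENNReal.toReal_mul]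
    exact Finset.sum_congr rfl fun s' _ => mul_comm _ _

variable [Fintype Z] [Fintype A]

/-- Here `φ` stands for the action probabilities of the evaluation policy. They depend only on
observations and actions, so they factor out of the sums over hidden states, rewards and the
preliminary observation. The unit action weights are not normalized, which is why this is not an
instance of the results for hidden policies. -/
theorem tsum_prefixWeight_obs (M : POMDP U Z A ρ) (k : ℕ)
    (φ : (Fin k → Z) → (Fin k → A) → ℝ≥0∞) (s : U) :
    ∑' (z : Z) (y : Fin k → Step U Z A ρ), φ (fun j => (y j).2.1) (fun j => (y j).2.2.1) *
      M.prefixWeight (fun _ _ _ => 1) z y s = ∑ zs, ∑ as, φ zs as * M.obsForward k zs as s := by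
  induction k generalizing s with
  | zero =>
    have : ∀ f : Fin 0 → Z, ∀ g : Fin 0 → A, φ f g = φ Fin.elim0 Fin.elim0 := fun f g => by
      rw [Subsingleton.elim f Fin.elim0, Subsingleton.elim g Fin.elim0]
    calc _ = ∑' z, φ Fin.elim0 Fin.elim0 * (M.init s * M.pre s z) := by
          refine tsum_congr fun z => ?_
          rw [tsum_eq_single (fun i : Fin 0 => i.elim0)
            (fun y hy => absurd (Subsingleton.elim _ _) hy), this]
          simp [prefixWeight, stateAt]
      _ = φ Fin.elim0 Fin.elim0 * M.init s := by
          rw [ENNReal.tsum_mul_left, ENNReal.tsum_mul_left, PMF.tsum_coe, mul_one]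
      _ = _ := by simp [this, obsForward]
  | succ k ih =>
    have e1 : ∀ (y : Fin k → Step U Z A ρ) (b : Step U Z A ρ),
        (fun j => ((Fin.snoc (α := fun _ => Step U Z A ρ) y b : Fin (k + 1) → _) j).2.1) =
        (Fin.snoc (α := fun _ => Z) (fun j => (y j).2.1) b.2.1 : Fin (k + 1) → Z) := by
      intro y b
      funext j
      refine Fin.lastCases ?_ (fun j => ?_) j <;> simp
    have e2 : ∀ (y : Fin k → Step U Z A ρ) (b : Step U Z A ρ),
        (fun j => ((Fin.snoc (α := fun _ => Step U Z A ρ) y b : Fin (k + 1) → _) j).2.2.1) =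
        (Fin.snoc (α := fun _ => A) (fun j => (y j).2.2.1) b.2.2.1 : Fin (k + 1) → A) := by
      intro y b
      funext j
      refine Fin.lastCases ?_ (fun j => ?_) j <;> simp
    calc _ = ∑' (b : Step U Z A ρ) (z : Z) (y : Fin k → Step U Z A ρ),
          (φ (Fin.snoc (α := fun _ => Z) (fun j => (y j).2.1) b.2.1)
            (Fin.snoc (α := fun _ => A) (fun j => (y j).2.2.1) b.2.2.1) *
          M.prefixWeight (fun _ _ _ => 1) z y b.1) *
          (M.stepWeight (fun _ _ _ => 1) k b * M.trans b.1 b.2.2.1 s) := by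
          rw [ENNReal.tsum_comm (α := Step U Z A ρ)]
          refine tsum_congr fun z => ?_
          rw [tsum_snoc]
          refine tsum_congr fun b => tsum_congr fun y => ?_
          rw [prefixWeight_snoc, e1, e2]
          ring
      _ = ∑' (b : Step U Z A ρ), (∑ zs : Fin k → Z, ∑ as : Fin k → A,
          φ (Fin.snoc (α := fun _ => Z) zs b.2.1) (Fin.snoc (α := fun _ => A) as b.2.2.1) *
            M.obsForward k zs as b.1) *
          (M.stepWeight (fun _ _ _ => 1) k b * M.trans b.1 b.2.2.1 s) := by
          refine tsum_congr fun b => ?_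
          simp only [ENNReal.tsum_mul_right]
          rw [ih fun zs as => φ (Fin.snoc (α := fun _ => Z) zs b.2.1)
            (Fin.snoc (α := fun _ => A) as b.2.2.1)]
      _ = ∑ s₀, ∑ z, ∑ a, (∑ zs : Fin k → Z, ∑ as : Fin k → A,
          φ (Fin.snoc (α := fun _ => Z) zs z) (Fin.snoc (α := fun _ => A) as a) *
            M.obsForward k zs as s₀) * (M.emit s₀ z * M.trans s₀ a s) := by
          rw [tsum_step]
          simp only [tsum_fintype (β := U), tsum_fintype (β := Z), tsum_fintype (β := A)]
          refine Finset.sum_congr rfl fun s₀ _ => Finset.sum_congr rfl fun z _ =>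
            Finset.sum_congr rfl fun a _ => ?_
          rw [ENNReal.tsum_mul_left]
          simp only [stepWeight, ENNReal.tsum_mul_right, ENNReal.tsum_mul_left, PMF.tsum_coe,
            mul_one]
      _ = _ := by
          rw [sum_snoc, Finset.sum_comm]
          refine Finset.sum_congr rfl fun z _ => ?_
          simp only [sum_snoc (S := A), obsForward, Fin.init_snoc, Fin.snoc_last, Finset.sum_mul,
            Finset.mul_sum]
          rw [Finset.sum_comm, Finset.sum_comm (γ := Fin k → Z)]
          refine Finset.sum_congr rfl fun a _ => ?_
          rw [Finset.sum_comm]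
          refine Finset.sum_congr rfl fun zs _ => ?_
          rw [Finset.sum_comm]
          refine Finset.sum_congr rfl fun as _ => Finset.sum_congr rfl fun s₀ _ => ?_
          ring

open Classical in
/-- The law of the reward at time `t` under an observable policy, as a sum over histories. -/
theorem prob_rew_obs (M : POMDP U Z A ρ) (πe : ObsPolicy Z A) (t : Fin (N + 1)) (r : ρ) :
    M.prob (N := N) (πe.toPolicy U) {τ | τ.rew t = r} =
      ∑ zs : Fin ((t : ℕ) + 1) → Z, ∑ as : Fin ((t : ℕ) + 1) → A,
        (∏ i : Fin ((t : ℕ) + 1), (πe i (prefixHist zs as i) (as i)).toReal) *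
        ((fun s => (M.emit s (zs (Fin.last t))).toReal *
            (M.reward s (as (Fin.last t)) r).toReal) ⬝ᵥ
          ((List.ofFn fun i : Fin (t : ℕ) => M.obsTrans (zs i.castSucc) (as i.castSucc)).reverse.prod
            *ᵥ fun s => (M.init s).toReal)) := by
  obtain ⟨t, ht⟩ := t
  obtain ⟨d, rfl⟩ : ∃ d, N = t + d := ⟨N - t, by omega⟩
  -- The reward at time `t` is unaffected by later steps, so the horizon may be taken to be `t`.
  rw [M.prob_rew_truncate]
  have key : ∑' τ, {τ : Traj U Z A ρ t | τ.rew (Fin.last t) = r}.indicator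
      (M.weight (πe.toPolicy U)) τ =
      ∑ zs : Fin (t + 1) → Z, ∑ as : Fin (t + 1) → A,
        (∏ i : Fin (t + 1), πe i (prefixHist zs as i) (as i)) *
        ∑ s, M.emit s (zs (Fin.last t)) * M.reward s (as (Fin.last t)) r *
          M.obsForward t (Fin.init zs) (Fin.init as) s := by
    have e1 : ∀ (z : Z) (y : Fin t → Step U Z A ρ) (b : Step U Z A ρ),
        (stepsEquiv U Z A ρ t
          (z, (Fin.snoc (α := fun _ => Step U Z A ρ) y b : Fin (t + 1) → _))).ob =
        (Fin.snoc (α := fun _ => Z) (fun j => (y j).2.1) b.2.1 : Fin (t + 1) → Z) := by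
      intro z y b
      funext j
      refine Fin.lastCases ?_ (fun j => ?_) j <;> simp [stepsEquiv]
    have e2 : ∀ (z : Z) (y : Fin t → Step U Z A ρ) (b : Step U Z A ρ),
        (stepsEquiv U Z A ρ t
          (z, (Fin.snoc (α := fun _ => Step U Z A ρ) y b : Fin (t + 1) → _))).act =
        (Fin.snoc (α := fun _ => A) (fun j => (y j).2.2.1) b.2.2.1 : Fin (t + 1) → A) := by
      intro z y b
      funext j
      refine Fin.lastCases ?_ (fun j => ?_) j <;> simp [stepsEquiv]
    have e3 : ∀ (z : Z) (y : Fin t → Step U Z A ρ) (b : Step U Z A ρ),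
        (stepsEquiv U Z A ρ t
          (z, (Fin.snoc (α := fun _ => Step U Z A ρ) y b : Fin (t + 1) → _))).rew (Fin.last t) =
        b.2.2.2 := by
      intro z y b
      simp [stepsEquiv]
    set Φ : (Fin (t + 1) → Z) → (Fin (t + 1) → A) → ℝ≥0∞ := fun zs as =>
      ∏ i : Fin (t + 1), πe i (prefixHist zs as i) (as i) with hΦ
    calc _ = ∑' (b : Step U Z A ρ) (z : Z) (y : Fin t → Step U Z A ρ),
          (Φ (Fin.snoc (α := fun _ => Z) (fun j => (y j).2.1) b.2.1)
            (Fin.snoc (α := fun _ => A) (fun j => (y j).2.2.1) b.2.2.1) *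
          M.prefixWeight (fun _ _ _ => 1) z y b.1) *
          (if b.2.2.2 = r then M.stepWeight (fun _ _ _ => 1) t b else 0) := by
          rw [← (stepsEquiv U Z A ρ t).tsum_eq, ENNReal.tsum_prod',
            ENNReal.tsum_comm (α := Step U Z A ρ)]
          refine tsum_congr fun z => ?_
          rw [tsum_snoc]
          refine tsum_congr fun b => tsum_congr fun y => ?_
          simp only [Set.indicator_apply, Set.mem_ofPred_eq, e3, weight_obs, pathWeight_snoc, e1, e2]
          split_ifs
          · ring
          · ring
      _ = ∑' (b : Step U Z A ρ), (∑ zs : Fin t → Z, ∑ as : Fin t → A,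
          Φ (Fin.snoc (α := fun _ => Z) zs b.2.1) (Fin.snoc (α := fun _ => A) as b.2.2.1) *
            M.obsForward t zs as b.1) *
          (if b.2.2.2 = r then M.stepWeight (fun _ _ _ => 1) t b else 0) := by
          refine tsum_congr fun b => ?_
          simp only [ENNReal.tsum_mul_right]
          rw [M.tsum_prefixWeight_obs t fun zs as => Φ (Fin.snoc (α := fun _ => Z) zs b.2.1)
            (Fin.snoc (α := fun _ => A) as b.2.2.1)]
      _ = ∑ s₀, ∑ z, ∑ a, (∑ zs : Fin t → Z, ∑ as : Fin t → A,
          Φ (Fin.snoc (α := fun _ => Z) zs z) (Fin.snoc (α := fun _ => A) as a) *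
            M.obsForward t zs as s₀) * (M.emit s₀ z * M.reward s₀ a r) := by
          rw [tsum_step]
          simp only [tsum_fintype (β := U), tsum_fintype (β := Z), tsum_fintype (β := A)]
          refine Finset.sum_congr rfl fun s₀ _ => Finset.sum_congr rfl fun z _ =>
            Finset.sum_congr rfl fun a _ => ?_
          rw [tsum_eq_single r (fun b hb => by simp [hb])]
          simp [stepWeight]
      _ = _ := by
          rw [sum_snoc, Finset.sum_comm]
          refine Finset.sum_congr rfl fun z _ => ?_
          simp only [sum_snoc (S := A), Fin.init_snoc, Fin.snoc_last, Finset.sum_mul,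
            Finset.mul_sum]
          rw [Finset.sum_comm, Finset.sum_comm (γ := Fin t → Z)]
          refine Finset.sum_congr rfl fun a _ => ?_
          rw [Finset.sum_comm]
          refine Finset.sum_congr rfl fun zs _ => ?_
          rw [Finset.sum_comm]
          refine Finset.sum_congr rfl fun as _ => Finset.sum_congr rfl fun s₀ _ => ?_
          ring
  have hfin1 : ∀ (zs : Fin (t + 1) → Z) (as : Fin (t + 1) → A) (s : U),
      M.emit s (zs (Fin.last t)) * M.reward s (as (Fin.last t)) r *
          M.obsForward t (Fin.init zs) (Fin.init as) s ≠ ∞ := fun zs as s =>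
    ENNReal.mul_ne_top (ENNReal.mul_ne_top (PMF.apply_ne_top _ _) (PMF.apply_ne_top _ _))
      (M.obsForward_ne_top _ _ _ _)
  have hfin2 : ∀ (zs : Fin (t + 1) → Z) (as : Fin (t + 1) → A),
      (∏ i : Fin (t + 1), πe i (prefixHist zs as i) (as i)) *
        ∑ s, M.emit s (zs (Fin.last t)) * M.reward s (as (Fin.last t)) r *
          M.obsForward t (Fin.init zs) (Fin.init as) s ≠ ∞ := fun zs as =>
    ENNReal.mul_ne_top (ENNReal.prod_ne_top fun i _ => PMF.apply_ne_top _ _)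
      (ENNReal.sum_ne_top.2 fun s _ => hfin1 zs as s)
  unfold prob
  rw [key, ENNReal.toReal_sum fun zs _ => ENNReal.sum_ne_top.2 fun as _ => hfin2 zs as]
  refine Finset.sum_congr rfl fun zs _ => ?_
  rw [ENNReal.toReal_sum fun as _ => hfin2 zs as]
  refine Finset.sum_congr rfl fun as _ => ?_
  rw [ENNReal.toReal_mul, ENNReal.toReal_prod, ENNReal.toReal_sum fun s _ => hfin1 zs as s]
  congr 1
  have := M.obsForward_toReal t (Fin.init zs) (Fin.init as)
  simp only [Fin.init] at this
  rw [← this]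
  simp only [dotProduct, ENNReal.toReal_mul]

end POMDP

/-! ### Estimation and identification -/

namespace POMDP

open scoped ENNReal

variable {U : Type u} {Z : Type v} {A : Type w} {ρ : Type x} {N : ℕ}

theorem pastLaw_nonneg (M : POMDP U Z A ρ) (π : HiddenPolicy U A) {k : ℕ} (h : Hist Z A (k - 1))
    (s : U) : 0 ≤ M.pastLaw π h s := ENNReal.toReal_nonneg

/-- The observable part of a trajectory as a trajectory with a single hidden state. -/
def ofObs (o : Z × (Fin (N + 1) → Z × A × ρ)) : Traj PUnit.{u + 1} Z A ρ N :=
  ⟨o.1, fun _ => PUnit.unit, fun i => (o.2 i).1, fun i => (o.2 i).2.1, fun i => (o.2 i).2.2⟩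

theorem tsum_weight_ofObs (M : POMDP U Z A ρ) (π : HiddenPolicy U A)
    (E : Set (Traj PUnit.{u + 1} Z A ρ N)) :
    ∑' τ, {τ : Traj U Z A ρ N | ofObs τ.obs ∈ E}.indicator (M.weight (π.toPolicy Z)) τ =
      ∑' o, {o | ofObs o ∈ E}.indicator (fun o =>
        ∑' τ, {τ : Traj U Z A ρ N | τ.obs = o}.indicator (M.weight (π.toPolicy Z)) τ) o := by
  classical
  have h1 : ∀ o, {o | ofObs o ∈ E}.indicator (fun o =>
        ∑' τ, {τ : Traj U Z A ρ N | τ.obs = o}.indicator (M.weight (π.toPolicy Z)) τ) o =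
      ∑' τ, if ofObs o ∈ E ∧ τ.obs = o then M.weight (N := N) (π.toPolicy Z) τ else 0 := by
    intro o
    by_cases h : ofObs o ∈ E <;> simp [Set.indicator_apply, h]
  simp only [h1]
  rw [ENNReal.tsum_comm]
  refine tsum_congr fun τ => ?_
  rw [tsum_eq_single τ.obs (fun o ho => by simp [ho.symm])]
  simp [Set.indicator_apply]

/-- Equality on atoms extends to observable events by summation, possibly infinite since the reward
set is arbitrary; finite mass allows passing back from real to extended values. The one-point hidden
space lets observable events be written with the usual trajectory maps. -/
theorem SameObservables.prob_eq {U' : Type u} {M : POMDP U Z A ρ} {π : HiddenPolicy U A}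
    {M' : POMDP U' Z A ρ} {π' : HiddenPolicy U' A} (h : SameObservables N M π M' π')
    (E : Set (Traj PUnit.{u + 1} Z A ρ N)) :
    M.prob (π.toPolicy Z) {τ | ofObs τ.obs ∈ E} = M'.prob (π'.toPolicy Z) {τ | ofObs τ.obs ∈ E} := by
  unfold prob
  rw [tsum_weight_ofObs, tsum_weight_ofObs]
  congr 1
  refine tsum_congr fun o => congrArg (fun g => Set.indicator _ g o) (funext fun o => ?_)
  exact (ENNReal.toReal_eq_toReal_iff' (M.tsum_weight_ne_top π _)
    (M'.tsum_weight_ne_top π' _)).1 (h o)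

variable [Fintype U] [Fintype Z] [Fintype A]

/-! ### Consequences of the rank assumption; correctness of the estimator. -/

section Assumptions

variable {M : POMDP U Z A ρ} {π : HiddenPolicy U A} {t : Fin (N + 1)}

open Classical in
theorem Assumptions.exists_inverses (hM : M.Assumptions π t) {i : Fin (N + 1)} (hi : i ≤ t)
    (a : A) : (∃ Y : Matrix U (Fut Z A (N - i)) ℝ, Y * M.futKernel π i a = 1) ∧
      ∃ X : Matrix (Hist Z A (i - 1)) U ℝ, M.stateKernel π i a * X = 1 := by
  have h := hM.rank_eq i hi a
  rw [futMatrix_eq] at h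
  exact Matrix.exists_inverses_of_rank_mul_eq _ _ h

/-- If the hidden state and action had joint probability zero, a row of `stateKernel` would vanish,
contradicting its right inverse. -/
theorem Assumptions.pos (hM : M.Assumptions π t) {i : Fin (N + 1)} (hi : i ≤ t) (a : A) (s : U) :
    (∑ h, M.pastLaw (k := i) π h s) * (π i s a).toReal ≠ 0 := by
  classical
  intro h0
  obtain ⟨-, X, hX⟩ := hM.exists_inverses hi a
  have hrow : ∀ h, M.stateKernel π i a s h = 0 := by
    intro h
    rcases mul_eq_zero.1 h0 with h1 | h1
    · have := (Finset.sum_eq_zero_iff_of_nonneg fun h _ => M.pastLaw_nonneg π h s).1 h1 h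
        (Finset.mem_univ h)
      simp [stateKernel, this]
    · simp [stateKernel, h1]
  have := congrFun (congrFun hX s) s
  rw [Matrix.mul_apply] at this
  simp [hrow] at this

/-- The joint law of the proxy history and the hidden state when the action is `a`. -/
noncomputable def jointPast (M : POMDP U Z A ρ) (π : HiddenPolicy U A) (i : Fin (N + 1)) (a : A) :
    Matrix (Hist Z A (i - 1)) U ℝ :=
  Matrix.of fun h s => M.pastLaw (k := i) π h s * (π i s a).toReal

open Classical in
-- Up to transposition, `jointPast` and `stateKernel` differ by dividing each history by its
-- probability. A null history is harmless: its inverse weight is `0`, and so is its column in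
-- `stateKernel`.
theorem Assumptions.exists_left_inverse_jointPast (hM : M.Assumptions π t) {i : Fin (N + 1)}
    (hi : i ≤ t) (a : A) : ∃ X : Matrix U (Hist Z A (i - 1)) ℝ, X * M.jointPast π i a = 1 := by
  obtain ⟨-, X, hX⟩ := hM.exists_inverses hi a
  refine ⟨Xᵀ * Matrix.diagonal fun h =>
    (M.prob (N := N) (π.toPolicy Z) {τ | τ.act i = a ∧ τ.past i = h})⁻¹, ?_⟩
  have h1 : (Matrix.diagonal fun h =>
      (M.prob (N := N) (π.toPolicy Z) {τ | τ.act i = a ∧ τ.past i = h})⁻¹) * M.jointPast π i a =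
      (M.stateKernel π i a)ᵀ := by
    ext h s
    rw [Matrix.diagonal_mul]
    simp only [jointPast, stateKernel, Matrix.of_apply, Matrix.transpose_apply]
    ring
  rw [Matrix.mul_assoc, h1, ← Matrix.transpose_mul, hX, Matrix.transpose_one]

/-- Admissible projection matrices exist. -/
theorem Assumptions.exists_nondegenerate (hM : M.Assumptions π t) :
    ∃ L : (i : Fin (N + 1)) → A → Matrix (Fin (Fintype.card U)) (Fut Z A (N - i)) ℝ,
      M.Nondegenerate π t L := by
  classical
  have key : ∀ (i : Fin (N + 1)) (a : A), ∃ L : Matrix (Fin (Fintype.card U)) (Fut Z A (N - i)) ℝ,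
      i ≤ t → L.rank = Fintype.card U ∧ (L * M.futMatrix π i a).rank = Fintype.card U := by
    intro i a
    by_cases hi : i ≤ t
    · obtain ⟨⟨Y, hY⟩, X, hX⟩ := hM.exists_inverses hi a
      -- A left inverse of `futKernel` is a valid projection: it turns the future–history matrix
      -- into `stateKernel`, with hidden states numbered by `e`.
      let e : Fin (Fintype.card U) ≃ U := (Fintype.equivFin U).symm
      have h1 : (Y.submatrix e id * M.futMatrix π i a) * X.submatrix id e = 1 := by
        rw [futMatrix_eq]
        calc Y.submatrix e id * (M.futKernel π i a * M.stateKernel π i a) * X.submatrix id e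
            = (Y * (M.futKernel π i a * M.stateKernel π i a) * X).submatrix e e := rfl
          _ = (Y * M.futKernel π i a * (M.stateKernel π i a * X)).submatrix e e := by
              simp only [Matrix.mul_assoc]
          _ = 1 := by rw [hY, hX, Matrix.mul_one, Matrix.submatrix_one_equiv]
      have h2 : (Y.submatrix e id * M.futMatrix π i a).rank = Fintype.card U := by
        refine le_antisymm ((Matrix.rank_le_card_height _).trans_eq (Fintype.card_fin _)) ?_
        have := Matrix.rank_mul_le_left (Y.submatrix e id * M.futMatrix π i a) (X.submatrix id e)
        rwa [h1, Matrix.rank_one, Fintype.card_fin] at this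
      refine ⟨Y.submatrix e id, fun _ => ⟨le_antisymm ((Matrix.rank_le_card_height _).trans_eq
        (Fintype.card_fin _)) ?_, h2⟩⟩
      exact h2.symm.trans_le (Matrix.rank_mul_le_left (Y.submatrix e id) (M.futMatrix π i a))
    · exact ⟨0, fun h => absurd h hi⟩
  choose L hL using key
  exact ⟨L, fun i hi a => hL i a hi⟩

open Classical in
-- The matrix `L i a * futKernel` is square, so the left inverse obtained from the rank is two-sided
-- and `Matrix.mul_pinv_mul_eq` applies.
theorem Nondegenerate.exists_inverse
    {L : (i : Fin (N + 1)) → A → Matrix (Fin (Fintype.card U)) (Fut Z A (N - i)) ℝ}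
    (hL : M.Nondegenerate π t L) {i : Fin (N + 1)} (hi : i ≤ t) (a : A) :
    ∃ C' : Matrix U (Fin (Fintype.card U)) ℝ, C' * (L i a * M.futKernel π i a) = 1 ∧
      M.stateKernel π i a * pinv (L i a * M.futMatrix π i a) = C' := by
  have h := (hL i hi a).2
  rw [futMatrix_eq, ← Matrix.mul_assoc] at h ⊢
  obtain ⟨⟨C', hC'⟩, X, hX⟩ := Matrix.exists_inverses_of_rank_mul_eq _ _ h
  have hC : L i a * M.futKernel π i a * C' = 1 :=
    (Matrix.mul_eq_one_comm_of_card_eq _ _ _ (Fintype.card_fin _).symm).1 hC'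
  exact ⟨C', hC', Matrix.mul_pinv_mul_eq hC' hC hX⟩

theorem Nondegenerate.prob_rew_eq_estimator
    {L : (i : Fin (N + 1)) → A → Matrix (Fin (Fintype.card U)) (Fut Z A (N - i)) ℝ}
    (hL : M.Nondegenerate π t L) (πe : ObsPolicy Z A) (r : ρ) :
    M.prob (N := N) (πe.toPolicy U) {τ | τ.rew t = r} = M.estimator π πe t L r := by
  classical
  have hle : (t : ℕ) + 1 ≤ N + 1 := t.2
  have hinv : ∀ (i : Fin ((t : ℕ) + 1)) (a : A), ∃ C' : Matrix U (Fin (Fintype.card U)) ℝ,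
      C' * (L (Fin.castLE hle i) a * M.futKernel π (Fin.castLE hle i) a) = 1 ∧
      M.stateKernel π (Fin.castLE hle i) a *
        pinv (L (Fin.castLE hle i) a * M.futMatrix π (Fin.castLE hle i) a) = C' := fun i a =>
    hL.exists_inverse (Fin.le_def.2 (by have := i.2; simp; omega)) a
  choose C' hC1 hC2 using hinv
  rw [prob_rew_obs]
  unfold estimator
  refine Finset.sum_congr rfl fun zs _ => Finset.sum_congr rfl fun as _ => ?_
  congr 1
  have hrow : M.rewRow π t r (zs (Fin.last t)) (as (Fin.last t)) ᵥ*
      pinv (L t (as (Fin.last t)) * M.futMatrix π t (as (Fin.last t))) =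
      (fun s => (M.emit s (zs (Fin.last t))).toReal * (M.reward s (as (Fin.last t)) r).toReal) ᵥ*
        C' (Fin.last t) (as (Fin.last t)) := by
    rw [rewRow_eq, Matrix.vecMul_vecMul]
    exact congrArg _ (hC2 (Fin.last t) (as (Fin.last t)))
  have hfac : ∀ i : Fin (t : ℕ), L (Fin.castLE t.is_le i).succ (as i.succ) *
      M.doMatrix π (Fin.castLE t.is_le i) (zs i.castSucc) (as i.castSucc) (as i.succ) *
      pinv (L (Fin.castLE t.is_le i).castSucc (as i.castSucc) *
        M.futMatrix π (Fin.castLE t.is_le i).castSucc (as i.castSucc)) =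
      (L (Fin.castLE hle i.succ) (as i.succ) * M.futKernel π (Fin.castLE hle i.succ) (as i.succ)) *
        M.obsTrans (zs i.castSucc) (as i.castSucc) * C' i.castSucc (as i.castSucc) := by
    intro i
    rw [doMatrix_eq, ← hC2 i.castSucc (as i.castSucc)]
    simp only [Matrix.mul_assoc]
    rfl
  have hinit : L 0 (as 0) *ᵥ M.doInit π N (as 0) =
      (L (Fin.castLE hle 0) (as 0) * M.futKernel π (Fin.castLE hle 0) (as 0)) *ᵥ
        fun s => (M.init s).toReal := by
    rw [doInit_eq, Matrix.mulVec_mulVec]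
    congr 1
    exact funext fun s => M.startLaw_eq π s
  -- With `C i = L i * futKernel`, the factors are `C (i+1) * T i * C' i` and the final vector is `C
  -- 0` applied to the initial law. The remaining `C (last t)` cancels against `C'` in the reward
  -- row.
  have htel := Matrix.prod_reverse_telescope (t : ℕ)
    (fun i => L (Fin.castLE hle i) (as i) * M.futKernel π (Fin.castLE hle i) (as i))
    (fun i => C' i (as i)) (fun i => M.obsTrans (zs i.castSucc) (as i.castSucc))
    fun i => hC1 i (as i)
  simp only [hfac]
  rw [hrow, hinit, Matrix.mulVec_mulVec, htel, ← Matrix.mulVec_mulVec,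
    Matrix.dotProduct_mulVec _ (_ * _), Matrix.vecMul_vecMul, hC1, Matrix.vecMul_one]

end Assumptions

/-! ### Two models with the same observable law: relabelling and identification. -/

section Identification

variable {U' : Type u} [Fintype U'] {M : POMDP U Z A ρ} {π : HiddenPolicy U A}
  {M' : POMDP U' Z A ρ} {π' : HiddenPolicy U' A}

variable {t : Fin (N + 1)}

/-- For each action, the observable data determine the joint law of the proxy history and the
hidden state and the conditional law of the future, up to a relabelling of the hidden states. -/
theorem SameObservables.exists_equiv_act (h : SameObservables N M π M' π')
    (hM : M.Assumptions π t) (hM' : M'.Assumptions π' t) {i : Fin (N + 1)} (hi : i ≤ t) (a : A) :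
    ∃ σ : U' ≃ U, (∀ k s, M'.jointPast π' i a k s = M.jointPast π i a k (σ s)) ∧
      ∀ f s, M'.futKernel π' i a f s = M.futKernel π i a f (σ s) := by
  classical
  obtain ⟨⟨Y, hY⟩, -⟩ := hM.exists_inverses hi a
  obtain ⟨⟨Y', hY'⟩, -⟩ := hM'.exists_inverses hi a
  obtain ⟨X, hX⟩ := hM.exists_left_inverse_jointPast hi a
  obtain ⟨X', hX'⟩ := hM'.exists_left_inverse_jointPast hi a
  obtain ⟨r, hr⟩ := hM.reward_distinct i hi a
  refine Matrix.exists_equiv_of_factorizations _ _ _ _ (fun s => (M.reward s a r).toReal)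
    (fun s => (M'.reward s a r).toReal) ?_ hX hX' hY hY' ?_ ?_ ?_ ?_
  · convert hr using 1
    exact funext fun s => (M.rewProb_eq π i a r s (hM.pos hi a s)).symm
  · ext k f
    have := h.prob_eq ({τ | τ.fut i = f} ∩ {τ | τ.act i = a ∧ τ.past i = k})
    exact (M.prob_fut_act_past π i a f k).symm.trans (this.trans (M'.prob_fut_act_past π' i a f k))
  · ext k f
    have := h.prob_eq {τ | (τ.past i = k ∧ τ.fut i = f ∧ τ.act i = a) ∧ τ.rew i = r}
    have := (M.prob_fut_rew_act_past π i a r f k).symm.trans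
      (this.trans (M'.prob_fut_rew_act_past π' i a r f k))
    rw [Matrix.mul_apply, Matrix.mul_apply]
    simpa only [Matrix.mul_diagonal, jointPast, futKernel, Matrix.of_apply,
      Matrix.transpose_apply] using this
  · exact fun s => M.sum_futLaw π i a _ s
  · exact fun s => M'.sum_futLaw π' i a _ s

/-- The relabelling of the hidden states does not depend on the action, and it respects the
behavior policy. -/
theorem SameObservables.exists_equiv (h : SameObservables N M π M' π')
    (hM : M.Assumptions π t) (hM' : M'.Assumptions π' t) {i : Fin (N + 1)} (hi : i ≤ t) :
    ∃ σ : U' ≃ U,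
      (∀ k s, M'.pastLaw (k := i) π' k s = M.pastLaw (k := i) π k (σ s)) ∧
      (∀ a s, (π' i s a).toReal = (π i (σ s) a).toReal) ∧
      ∀ a f s, M'.futKernel π' i a f s = M.futKernel π i a f (σ s) := by
  classical
  choose σ hσ using fun a => h.exists_equiv_act hM hM' hi a
  -- Up to policy factors, the past laws of `σ a s` and `σ b s` both equal that of `s` in the second
  -- model. If the labels differed, the row of the left inverse `X` dual to `σ a s` would send one
  -- side of `hk` to `π' i s b` and the other to zero, against positivity.
  have hconst : ∀ a b s, σ a s = σ b s := by
    intro a b s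
    by_contra hne
    obtain ⟨X, hX⟩ := hM.exists_left_inverse_jointPast hi a
    have hX1 : ∀ v, (∑ k, X (σ a s) k * M.pastLaw (k := i) π k v) * (π i v a).toReal =
        (1 : Matrix U U ℝ) (σ a s) v := by
      intro v
      rw [← hX, Matrix.mul_apply, Finset.sum_mul]
      exact Finset.sum_congr rfl fun k _ => by simp only [jointPast, Matrix.of_apply]; ring
    have hb : ∑ k, X (σ a s) k * M.pastLaw (k := i) π k (σ b s) = 0 := by
      have := hX1 (σ b s)
      rw [Matrix.one_apply_ne hne] at this
      exact (mul_eq_zero.1 this).resolve_right (right_ne_zero_of_mul (hM.pos hi a (σ b s)))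
    have hk : ∀ k, M.pastLaw (k := i) π k (σ a s) * (π i (σ a s) a).toReal * (π' i s b).toReal =
        M.pastLaw (k := i) π k (σ b s) * ((π i (σ b s) b).toReal * (π' i s a).toReal) := by
      intro k
      have e1 := (hσ a).1 k s
      have e2 := (hσ b).1 k s
      simp only [jointPast, Matrix.of_apply] at e1 e2
      rw [← e1, ← mul_assoc, ← e2]
      ring
    have h1 : (π' i s b).toReal = 0 := by
      calc (π' i s b).toReal = (∑ k, X (σ a s) k * M.pastLaw (k := i) π k (σ a s)) *
            (π i (σ a s) a).toReal * (π' i s b).toReal := by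
            rw [hX1, Matrix.one_apply_eq, one_mul]
        _ = (∑ k, X (σ a s) k * M.pastLaw (k := i) π k (σ b s)) *
            ((π i (σ b s) b).toReal * (π' i s a).toReal) := by
            rw [Finset.sum_mul, Finset.sum_mul, Finset.sum_mul]
            refine Finset.sum_congr rfl fun k _ => ?_
            rw [mul_assoc, mul_assoc, mul_assoc, ← hk k]
            ring
        _ = 0 := by rw [hb, zero_mul]
    exact right_ne_zero_of_mul (hM'.pos hi b s) h1
  -- Any action may supply the common relabelling; one exists because the laws in the model have
  -- nonempty support.
  obtain ⟨s₀, -⟩ := M.init.support_nonempty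
  obtain ⟨a₀, -⟩ := (π 0 s₀).support_nonempty
  -- Summing over all actions removes the behavior policy from `jointPast`; this needs the same
  -- label for every action.
  have hpast : ∀ k s, M'.pastLaw (k := i) π' k s = M.pastLaw (k := i) π k (σ a₀ s) := by
    intro k s
    calc M'.pastLaw (k := i) π' k s = ∑ a, M'.jointPast π' i a k s := by
          simp only [jointPast, Matrix.of_apply, ← Finset.mul_sum, sum_pmf_toReal, mul_one]
      _ = ∑ a, M.jointPast π i a k (σ a₀ s) :=
          Finset.sum_congr rfl fun a _ => by rw [(hσ a).1, hconst a a₀]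
      _ = _ := by
          simp only [jointPast, Matrix.of_apply, ← Finset.mul_sum, sum_pmf_toReal, mul_one]
  refine ⟨σ a₀, hpast, fun a s => ?_, fun a f s => ?_⟩
  · have h1 : (∑ k, M'.pastLaw (k := i) π' k s) * (π' i s a).toReal =
        (∑ k, M'.pastLaw (k := i) π' k s) * (π i (σ a₀ s) a).toReal := by
      rw [Finset.sum_mul, Finset.sum_mul]
      refine Finset.sum_congr rfl fun k _ => ?_
      have := (hσ a).1 k s
      simp only [jointPast, Matrix.of_apply] at this
      rw [this, hconst a a₀, hpast]
    exact mul_left_cancel₀ (left_ne_zero_of_mul (hM'.pos hi a s)) h1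
  · rw [(hσ a).2, hconst a a₀]

theorem SameObservables.doInit_eq (h : SameObservables N M π M' π')
    (hM : M.Assumptions π t) (hM' : M'.Assumptions π' t) (a : A) :
    M.doInit π N a = M'.doInit π' N a := by
  obtain ⟨σ, h1, -, h3⟩ := h.exists_equiv hM hM' (Fin.zero_le t)
  rw [POMDP.doInit_eq, POMDP.doInit_eq]
  ext f
  simp only [Matrix.mulVec, dotProduct]
  rw [← σ.sum_comp]
  refine Finset.sum_congr rfl fun s _ => ?_
  rw [h3]
  congr 1
  exact (Finset.sum_congr rfl fun k _ => h1 k s).symm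

/-- The observational counterpart of `POMDP.doMatrix_eq`: it differs only by the behavior
probability of the later action. -/
theorem condProb_succ (M : POMDP U Z A ρ) (π : HiddenPolicy U A)
    (i : Fin N) (f : Fut Z A (N - i.succ)) (a' a : A) (z : Z) (k : Hist Z A (i.castSucc - 1)) :
    M.prob (N := N) (π.toPolicy Z) {τ | τ.fut i.succ = f ∧ τ.act i.succ = a' ∧
      τ.ob i.castSucc = z ∧ τ.act i.castSucc = a ∧ τ.past i.castSucc = k} /
      M.prob (N := N) (π.toPolicy Z) {τ | τ.act i.castSucc = a ∧ τ.past i.castSucc = k} =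
    ∑ s', M.futKernel π i.succ a' f s' * ((π i.succ s' a').toReal *
      (M.obsTrans z a * M.stateKernel π i.castSucc a) s' k) := by
  rw [prob_succ, Finset.sum_div]
  refine Finset.sum_congr rfl fun s' _ => ?_
  simp only [futKernel, Matrix.of_apply, Matrix.mul_apply, obsTrans, stateKernel]
  rw [mul_comm, mul_div_assoc, mul_comm (∑ s, _) (π _ _ _).toReal, mul_div_assoc, Finset.sum_div]
  congr 2
  exact Finset.sum_congr rfl fun s _ => by ring

/-- Only the relabelling at time `i + 1` is needed: the columns of `G` and `G'` are indexed by
observable histories, and the hidden state at time `i` is already summed out. -/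
theorem SameObservables.doMatrix_eq (h : SameObservables N M π M' π')
    (hM : M.Assumptions π t) (hM' : M'.Assumptions π' t) (i : Fin N) (hi : i.succ ≤ t) (z : Z)
    (a a' : A) : M.doMatrix π i z a a' = M'.doMatrix π' i z a a' := by
  classical
  obtain ⟨σ, -, h2, h3⟩ := h.exists_equiv hM hM' hi
  obtain ⟨⟨Y, hY⟩, -⟩ := hM.exists_inverses hi a'
  rw [POMDP.doMatrix_eq, POMDP.doMatrix_eq, Matrix.mul_assoc, Matrix.mul_assoc]
  set G := M.obsTrans z a * M.stateKernel π i.castSucc a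
  set G' := M'.obsTrans z a * M'.stateKernel π' i.castSucc a
  have key : ∀ f k, ∑ s, M.futKernel π i.succ a' f s * ((π i.succ s a').toReal * G s k) =
      ∑ s, M.futKernel π i.succ a' f s * ((π i.succ s a').toReal * G' (σ.symm s) k) := by
    intro f k
    have hobs := congrArg₂ (· / ·) (h.prob_eq {τ | τ.fut i.succ = f ∧ τ.act i.succ = a' ∧
      τ.ob i.castSucc = z ∧ τ.act i.castSucc = a ∧ τ.past i.castSucc = k})
      (h.prob_eq {τ | τ.act i.castSucc = a ∧ τ.past i.castSucc = k})
    refine (M.condProb_succ π i f a' a z k).symm.trans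
      (hobs.trans ((M'.condProb_succ π' i f a' a z k).trans ?_))
    rw [← σ.sum_comp]
    refine Finset.sum_congr rfl fun s _ => ?_
    rw [h3, h2, σ.symm_apply_apply]
  have hG : ∀ s k, G s k = G' (σ.symm s) k := by
    intro s k
    have e1 : M.futKernel π i.succ a' *ᵥ (fun s => (π i.succ s a').toReal * G s k) =
        M.futKernel π i.succ a' *ᵥ fun s => (π i.succ s a').toReal * G' (σ.symm s) k :=
      funext fun f => key f k
    -- The left inverse cancels the future kernel, after which the positive behavior probability is
    -- divided out.
    have e2 := congrArg (Y *ᵥ ·) e1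
    simp only [Matrix.mulVec_mulVec, hY, Matrix.one_mulVec] at e2
    exact mul_left_cancel₀ (right_ne_zero_of_mul (hM.pos hi a' s)) (congrFun e2 s)
  ext f k
  rw [Matrix.mul_apply, Matrix.mul_apply, ← σ.sum_comp]
  refine Finset.sum_congr rfl fun s _ => ?_
  rw [hG, h3, σ.symm_apply_apply]

end Identification

/-! ### Factorization of the bordered moment matrices. -/

section Moments

/-- A function is a linear image of its total sum and its values at all points but one. -/
theorem exists_unborder {α : Type*} [Fintype α] (x₀ : α) :
    ∃ E : α → Option {x // x ≠ x₀} → ℝ, ∀ (_ : Fintype (Option {x // x ≠ x₀})) (g : α → ℝ) (x : α),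
      ∑ k, E x k * ∑ y, {y | ∀ x ∈ k, y = x.1}.indicator g y = g x := by
  classical
  have hsome : ∀ (g : α → ℝ) (x : {x // x ≠ x₀}),
      ∑ y, {y | ∀ x' ∈ some x, y = x'.1}.indicator g y = g x := by
    intro g x
    simp [Set.indicator_apply]
  have hnone : ∀ (g : α → ℝ), ∑ y, {y | ∀ x' ∈ (none : Option {x // x ≠ x₀}),
      y = x'.1}.indicator g y = ∑ y, g y := by
    intro g
    simp
  -- At the omitted point the value is the total minus all the others; elsewhere it is read off
  -- directly.
  refine ⟨fun x k => if h : x = x₀ then k.elim 1 fun _ => -1 else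
    if k = some ⟨x, h⟩ then 1 else 0, fun inst g x => ?_⟩
  rw [show inst = instFintypeOption from Subsingleton.elim _ _]
  by_cases h : x = x₀
  · subst h
    rw [Fintype.sum_option, hnone]
    simp only [hsome, dif_pos, Option.elim, one_mul, neg_one_mul, Finset.sum_neg_distrib]
    have := Fintype.sum_eq_add_sum_subtype_ne g x
    rw [this]
    ring
  · rw [Finset.sum_eq_single (some ⟨x, h⟩)]
    · rw [hsome]; simp [h]
    · intro k _ hk; simp [h, hk]
    · simp

variable {M : POMDP U Z A ρ} {π : HiddenPolicy U A} {t : Fin (N + 1)}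

/-- The factor of the bordered moment matrices that depends on the proxy histories. -/
noncomputable def momentPast (M : POMDP U Z A ρ) (π : HiddenPolicy U A) (i : Fin (N + 1)) (a : A)
    (h₀ : Hist Z A (i - 1)) : Matrix (Option {h // h ≠ h₀}) U ℝ :=
  Matrix.of fun k s => (∑ h, {h | ∀ h' ∈ k, h = h'.1}.indicator
    (fun h => M.pastLaw (k := i) π h s) h) * (π i s a).toReal /
      M.prob (N := N) (π.toPolicy Z) {τ | τ.act i = a}

/-- Positivity of the hidden state and action cancels the common factor, leaving the future kernel
summed over the event. -/
theorem Assumptions.momentU_apply (hM : M.Assumptions π t) {i : Fin (N + 1)} (hi : i ≤ t) (a : A)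
    (f₀ : Fut Z A (N - i)) (s : U) (l : Option {f // f ≠ f₀}) :
    M.momentU π i a f₀ s l =
      ∑ f, {f | ∀ f' ∈ l, f = f'.1}.indicator (fun f => M.futKernel π i a f s) f := by
  have h1 := M.prob_act_state (N := N) π i a {f | ∀ f' ∈ l, f = f'.1} s Set.univ
  have h2 := M.prob_act_state (N := N) π i a Set.univ s Set.univ
  simp only [Set.mem_univ, and_true, Set.indicator_univ, sum_futLaw, mul_one, PMF.tsum_coe,
    ENNReal.toReal_one, Set.ofPred_true, Set.univ_inter] at h1 h2
  unfold momentU condProb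
  rw [Matrix.of_apply, h2]
  exact (congrArg (· / _) h1).trans (mul_div_cancel_left₀ _ (hM.pos hi a s))

theorem prob_moment (M : POMDP U Z A ρ) (π : HiddenPolicy U A) (i : Fin (N + 1)) (a : A)
    (h₀ : Hist Z A (i - 1)) (f₀ : Fut Z A (N - i)) (k : Option {h // h ≠ h₀})
    (l : Option {f // f ≠ f₀}) (R : Set ρ) :
    M.prob (N := N) (π.toPolicy Z)
      (pastEvent i h₀ k ∩ futEvent i f₀ l ∩ {τ | τ.rew i ∈ R} ∩ {τ | τ.act i = a}) =
    ∑ s, (∑ h, {h | ∀ h' ∈ k, h = h'.1}.indicator (fun h => M.pastLaw (k := i) π h s) h) *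
      (π i s a).toReal * (∑' r, R.indicator (M.reward s a) r).toReal *
      ∑ f, {f | ∀ f' ∈ l, f = f'.1}.indicator (fun f => M.futLaw π i a f s) f := by
  have h1 := M.prob_event (N := N) π i {h | ∀ h' ∈ k, h = h'.1} {f | ∀ f' ∈ l, f = f'.1} a
    Set.univ R
  simp only [Set.indicator_univ] at h1
  rw [← h1]
  refine congrArg _ (Set.ext fun τ => ?_)
  simp only [pastEvent, futEvent, Set.mem_inter_iff, Set.mem_ofPred_eq, Set.mem_univ]
  tauto

theorem Assumptions.momentP_eq (hM : M.Assumptions π t) {i : Fin (N + 1)} (hi : i ≤ t) (a : A)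
    (h₀ : Hist Z A (i - 1)) (f₀ : Fut Z A (N - i)) :
    M.momentP π i a h₀ f₀ = M.momentPast π i a h₀ * M.momentU π i a f₀ := by
  ext k l
  have h1 := M.prob_moment π i a h₀ f₀ k l Set.univ
  simp only [Set.mem_univ, Set.ofPred_true, Set.inter_univ, tsum_reward_univ, mul_one] at h1
  unfold momentP condProb
  rw [Matrix.of_apply, h1, Finset.sum_div, Matrix.mul_apply]
  refine Finset.sum_congr rfl fun s _ => ?_
  rw [hM.momentU_apply hi]
  simp only [momentPast, futKernel, Matrix.of_apply]
  ring

open Classical in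
theorem Assumptions.momentQ_eq (hM : M.Assumptions π t) {i : Fin (N + 1)} (hi : i ≤ t) (a : A)
    (r : ρ) (h₀ : Hist Z A (i - 1)) (f₀ : Fut Z A (N - i)) :
    M.momentQ π i a r h₀ f₀ = M.momentPast π i a h₀ * Matrix.diagonal (M.rewProb (N := N) π i r a) *
      M.momentU π i a f₀ := by
  ext k l
  have h1 := M.prob_moment π i a h₀ f₀ k l {r}
  simp only [Set.mem_singleton_iff, tsum_reward_singleton] at h1
  unfold momentQ condProb
  rw [Matrix.of_apply, h1, Finset.sum_div, Matrix.mul_apply]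
  refine Finset.sum_congr rfl fun s _ => ?_
  rw [hM.momentU_apply hi, Matrix.mul_diagonal, M.rewProb_eq π i a r s (hM.pos hi a s)]
  simp only [momentPast, futKernel, Matrix.of_apply]
  ring

/-- A single hidden state already contributes a positive term to a sum of nonnegative ones. -/
theorem Assumptions.prob_act_ne_zero (hM : M.Assumptions π t) {i : Fin (N + 1)} (hi : i ≤ t)
    (a : A) : M.prob (N := N) (π.toPolicy Z) {τ | τ.act i = a} ≠ 0 := by
  have h1 := M.prob_event (N := N) π i Set.univ Set.univ a Set.univ Set.univ
  simp only [Set.mem_univ, true_and, and_true, Set.indicator_univ, sum_futLaw, PMF.tsum_coe,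
    ENNReal.toReal_one, mul_one] at h1
  obtain ⟨s₀, -⟩ := M.init.support_nonempty
  intro h0
  rw [h1] at h0
  exact hM.pos hi a s₀ ((Finset.sum_eq_zero_iff_of_nonneg fun s _ =>
    mul_nonneg (Finset.sum_nonneg fun h _ => M.pastLaw_nonneg π h s) ENNReal.toReal_nonneg).1 h0
    s₀ (Finset.mem_univ _))

open Classical in
-- Bordering loses nothing: the matrix `E`, scaled by the probability of the action, recovers
-- `jointPast`, whose left inverse is then composed with it.
theorem Assumptions.exists_left_inverse_momentPast (hM : M.Assumptions π t) {i : Fin (N + 1)}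
    (hi : i ≤ t) (a : A) (h₀ : Hist Z A (i - 1)) :
    ∃ X : Matrix U (Option {h // h ≠ h₀}) ℝ, X * M.momentPast π i a h₀ = 1 := by
  obtain ⟨X, hX⟩ := hM.exists_left_inverse_jointPast hi a
  obtain ⟨E, hE⟩ := exists_unborder h₀
  refine ⟨X * (M.prob (N := N) (π.toPolicy Z) {τ | τ.act i = a} • Matrix.of E), ?_⟩
  rw [Matrix.mul_assoc, ← hX]
  congr 1
  ext h s
  have h1 := hE inferInstance (fun h => M.pastLaw (k := i) π h s) h
  rw [Matrix.smul_mul, Matrix.smul_apply, Matrix.mul_apply, smul_eq_mul, Finset.mul_sum]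
  simp only [jointPast, Matrix.of_apply, momentPast]
  rw [← h1, Finset.sum_mul]
  refine Finset.sum_congr rfl fun k _ => ?_
  have := hM.prob_act_ne_zero hi a
  field_simp

open Classical in
-- Undoing the border on the columns gives the transpose of `futKernel`, so its left inverse
-- transposes to a right inverse.
theorem Assumptions.exists_right_inverse_momentU (hM : M.Assumptions π t) {i : Fin (N + 1)}
    (hi : i ≤ t) (a : A) (f₀ : Fut Z A (N - i)) :
    ∃ X : Matrix (Option {f // f ≠ f₀}) U ℝ, M.momentU π i a f₀ * X = 1 := by
  obtain ⟨⟨Y, hY⟩, -⟩ := hM.exists_inverses hi a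
  obtain ⟨E, hE⟩ := exists_unborder f₀
  refine ⟨(Matrix.of E)ᵀ * Yᵀ, ?_⟩
  rw [← Matrix.mul_assoc, ← Matrix.transpose_one, ← hY, Matrix.transpose_mul]
  congr 1
  ext s f
  have h1 := hE inferInstance (fun f => M.futKernel π i a f s) f
  rw [Matrix.mul_apply, Matrix.transpose_apply, ← h1]
  exact Finset.sum_congr rfl fun l _ => by
    rw [hM.momentU_apply hi, mul_comm]; rfl

end Moments

end POMDP

open Classical in
theorem theorem4 {U : Type u} {Z : Type v} {A : Type w} {ρ : Type x}
    [Fintype U] [Fintype Z] [Fintype A]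
    (N : ℕ) (M : POMDP U Z A ρ) (πb : HiddenPolicy U A) (t : Fin (N + 1))
    (hM : M.Assumptions πb t) :
    -- admissible projection matrices exist
    (∃ L : (i : Fin (N + 1)) → A → Matrix (Fin (Fintype.card U)) (Fut Z A (N - i)) ℝ,
      M.Nondegenerate πb t L) ∧
    -- for each choice of them, the estimator equals the probability under the evaluation policy
    (∀ L : (i : Fin (N + 1)) → A → Matrix (Fin (Fintype.card U)) (Fut Z A (N - i)) ℝ,
      M.Nondegenerate πb t L → ∀ (πe : ObsPolicy Z A) (r : ρ),
        M.prob (N := N) (πe.toPolicy U) {τ | τ.rew t = r} = M.estimator πb πe t L r) ∧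
    -- the interventional matrices are determined by the law of the observable data
    (∀ (U' : Type u) [Fintype U'] (M' : POMDP U' Z A ρ) (πb' : HiddenPolicy U' A),
      M'.Assumptions πb' t → POMDP.SameObservables N M πb M' πb' →
        (∀ i : Fin N, i.succ ≤ t → ∀ (z : Z) (a a' : A),
          M.doMatrix πb i z a a' = M'.doMatrix πb' i z a a') ∧
        ∀ a : A, M.doInit πb N a = M'.doInit πb' N a) ∧
    -- eigendecomposition of the observable matrix `(P L(Λ))⁺ Q L(Λ)`
    (∀ i ≤ t, ∀ (a : A) (h₀ : Hist Z A (i - 1)) (f₀ : Fut Z A (N - i)),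
      (∃ Λ : Fin (Fintype.card U) → Option {f // f ≠ f₀}, none ∈ Set.range Λ ∧
        LinearIndependent ℝ fun j => (M.momentP πb i a h₀ f₀).col (Λ j)) ∧
      ∀ Λ : Fin (Fintype.card U) → Option {f // f ≠ f₀}, none ∈ Set.range Λ →
        LinearIndependent ℝ (fun j => (M.momentP πb i a h₀ f₀).col (Λ j)) →
        ∀ e : Fin (Fintype.card U) ≃ U,
          IsUnit ((M.momentU πb i a f₀).submatrix e Λ) ∧
          ∀ r : ρ,
            pinv ((M.momentP πb i a h₀ f₀).submatrix id Λ) *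
                (M.momentQ πb i a r h₀ f₀).submatrix id Λ =
              ((M.momentU πb i a f₀).submatrix e Λ)⁻¹ *
                Matrix.diagonal (fun j => M.rewProb πb i r a (e j)) *
                (M.momentU πb i a f₀).submatrix e Λ) := by
  refine ⟨hM.exists_nondegenerate, fun L hL πe r => hL.prob_rew_eq_estimator πe r,
    fun U' _ M' πb' hM' hobs => ⟨fun i hi z a a' => hobs.doMatrix_eq hM hM' i hi z a a',
      fun a => hobs.doInit_eq hM hM' a⟩, fun i hi a h₀ f₀ => ?_⟩
  obtain ⟨X, hX⟩ := hM.exists_left_inverse_momentPast hi a h₀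
  obtain ⟨Y, hY⟩ := hM.exists_right_inverse_momentU hi a f₀
  rw [hM.momentP_eq hi a h₀ f₀]
  constructor
  · have hnone : (M.momentU πb i a f₀).col none ≠ 0 := by
      obtain ⟨s₀, -⟩ := M.init.support_nonempty
      intro h0
      have h1 := congrFun h0 s₀
      rw [Matrix.col_apply, hM.momentU_apply hi] at h1
      have h2 := M.sum_futLaw πb i a (N - i) s₀
      simp [POMDP.futKernel, h2] at h1
    obtain ⟨Λ, h1, h2⟩ := Matrix.exists_linearIndependent_col _ hY none hnone
    exact ⟨Λ, h1, (Matrix.linearIndependent_mul_col_iff hX _ Λ).2 h2⟩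
  · intro Λ _ hΛ e
    have hu := (Matrix.linearIndependent_mul_col_iff hX _ Λ).1 hΛ
    refine ⟨(Matrix.pinv_mul_submatrix hX _ (fun _ => 0) Λ e hu).1, fun r => ?_⟩
    rw [hM.momentQ_eq hi a r h₀ f₀]
    convert (Matrix.pinv_mul_submatrix hX _ (M.rewProb πb i r a) Λ e hu).2
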